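/- Conventions. Let $\mathbb W$ be the class of tracial $\mathrm W^*$-algebras $(\mathcal A,\tau)$ that are separable in the $\sigma$-weak operator topology, with $\tau$ a faithful normal tracial state. For $\mathbf Y\in\mathcal A^d$ put $\|\mathbf Y\|_\alpha=(\sum_j\tau((Y_j^*Y_j)^{\alpha/2}))^{1/\alpha}$ for $1\le\alpha<\infty$ and $\|\mathbf Y\|_\infty=\max_j\|Y_j\|$, and $\langle\mathbf Y,\mathbf Z\rangle_\tau=\sum_j\tau(Y_j^*Z_j)$. A non-commutative law is a unital, positive, tracial, exponentially bounded linear functional on $\mathbb C\langle x_1,\dots,x_d\rangle$; $\Sigma_d$ is the set of these, and $\lambda_{\mathbf X}(p)=\tau(p(\mathbf X))$ for $\mathbf X\in\mathcal A_{\mathrm{sa}}^d$. For a real-multilinear $\Lambda:(\mathcal A_{\mathrm{sa}}^d)^\ell\to\mathcal A^{d'}$, let $\|\Lambda\|_{\mathscr M^\ell,\mathrm{tr}}$ be the supremum of $\|\Lambda[\mathbf Y_1,\dots,\mathbf Y_\ell]\|_\alpha$ (with $\Lambda$ extended complex-multilinearly) over all $\alpha,\alpha_1,\dots,\alpha_\ell\in[1,\infty]$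 with $1/\alpha=\sum_i1/\alpha_i$ and all $\mathbf Y_i\in\mathcal A^d$ with $\|\mathbf Y_i\|_{\alpha_i}\le1$. The space $C_{\mathrm{tr}}(\mathbb R^{*d},\mathscr M^\ell)^{d'}$ consists of the families $\mathbf f=(\mathbf f^{\mathcal A,\tau})_{(\mathcal A,\tau)\in\mathbb W}$ of functions $\mathbf f^{\mathcal A,\tau}(\mathbf X)[\mathbf Y_1,\dots,\mathbf Y_\ell]\in\mathcal A^{d'}$ of self-adjoint $d$-tuples, real-multilinear in the $\mathbf Y_i$, such that for all $R,\varepsilon>0$ there is a $d'$-tuple $\mathbf g$ of trace polynomials (linear combinations of products $\mathrm{tr}(p_1)\cdots\mathrm{tr}(p_n)p_0$ of words), multilinear in $\mathbf y_1,\dots,\mathbf y_\ell$, with $\sup_{(\mathcal A,\tau)\in\mathbb W}\sup_{\|\mathbf X\|_\infty\le R}\|(\mathbf f-\mathbf g)^{\mathcal A,\tau}(\mathbf X)\|_{\mathscr M^\ell,\mathrm{tr}}<\varepsilon$. For $k\in\mathbb N_0\cup\{\infty\}$, $f\in C^k_{\mathrm{tr}}(\mathbb R^{*d})$ means that for every integer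 $0\le n\le k$ the iterated directional derivatives of order $n$ of $f^{\mathcal A,\tau}$ exist in operator norm and are given by an element $\partial^nf$ of $C_{\mathrm{tr}}(\mathbb R^{*d},\mathscr M^n)$. Put $\mathrm{tr}(f)^{\mathcal A,\tau}(\mathbf X)=\tau(f^{\mathcal A,\tau}(\mathbf X))1$; $\mathrm{tr}(C^k_{\mathrm{tr}}(\mathbb R^{*d}))_{\mathrm{sa}}$ is the set of real-valued functions of this form. The gradient $\nabla\phi$ of such a function ($k\ge1$) is given by $\partial\phi^{\mathcal A,\tau}(\mathbf X)[\mathbf Y]=\langle\mathbf Y,\nabla\phi^{\mathcal A,\tau}(\mathbf X)\rangle_\tau$ for $\mathbf Y\in\mathcal A_{\mathrm{sa}}^d$. Write $\mathrm{id}(\mathbf X)=\mathbf X$, $\mathrm{Id}(\mathbf X)[\mathbf Y]=\mathbf Y$ and $\|\mathbf F\|_{BC_{\mathrm{tr}}(\mathbb R^{*d},\mathscr M^1)^d}=\sup_{(\mathcal A,\tau)\in\mathbb W}\sup_{\mathbf X\in\mathcal A_{\mathrm{sa}}^d}\|\mathbf F^{\mathcal A,\tau}(\mathbf X)\|_{\mathscr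 M^1,\mathrm{tr}}$. For $\mu\in\Sigma_d$ choose $(\mathcal A,\tau)\in\mathbb W$ and $\mathbf X\in\mathcal A_{\mathrm{sa}}^d$ with $\lambda_{\mathbf X}=\mu$, and put $(\nabla\phi)_*\mu=\lambda_{\nabla\phi^{\mathcal A,\tau}(\mathbf X)}$ and $\tilde\mu[f]=f^{\mathcal A,\tau}(\mathbf X)$ for scalar-valued $f\in\mathrm{tr}(C_{\mathrm{tr}}(\mathbb R^{*d}))$; these do not depend on the choice. In particular $\langle\nabla\phi-\mathrm{id},\nabla\phi-\mathrm{id}\rangle_{\mathrm{tr}}$ is the scalar-valued function $\mathbf X\mapsto\|\nabla\phi^{\mathcal A,\tau}(\mathbf X)-\mathbf X\|_2^2$. For $\mu,\nu\in\Sigma_d$ let $$d_{W,2}(\mu,\nu)=\inf\{\|\mathbf X-\mathbf Y\|_2:(\mathcal A,\tau)\in\mathbb W,\ \mathbf X,\mathbf Y\in\mathcal A_{\mathrm{sa}}^d,\ \lambda_{\mathbf X}=\mu,\ \lambda_{\mathbf Y}=\nu\},$$ and call $\mathbf X,\mathbf Y$ attaining this infimum an optimal coupling of $\mu$ and $\nu$.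 Proposition. Let $\phi\in\mathrm{tr}(C^k_{\mathrm{tr}}(\mathbb R^{*d}))_{\mathrm{sa}}$ for some $k\in\mathbb N\cup\{\infty\}$ with $k\ge2$, and suppose that for some real $K>0$ $$\|\partial\nabla\phi-K\,\mathrm{Id}\|_{BC_{\mathrm{tr}}(\mathbb R^{*d},\mathscr M^1)^d}<K.$$ Then for every $\mu\in\Sigma_d$, $$d_{W,2}(\mu,(\nabla\phi)_*\mu)=\tilde\mu[\langle\nabla\phi-\mathrm{id},\nabla\phi-\mathrm{id}\rangle_{\mathrm{tr}}]^{1/2}.$$ In other words, for every $(\mathcal A,\tau)\in\mathbb W$ and every $\mathbf X\in\mathcal A_{\mathrm{sa}}^d$, the tuples $\mathbf X$ and $\nabla\phi^{\mathcal A,\tau}(\mathbf X)$ are an optimal coupling of $\lambda_{\mathbf X}$ and $(\nabla\phi)_*\lambda_{\mathbf X}$. -/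

import Mathlib

open scoped ENNReal ComplexOrder Topology

noncomputable section

/-! ### Tracial von Neumann algebras -/

section SigmaWeak

variable (H : Type) [NormedAddCommGroup H] [InnerProductSpace ℂ H]

/-- The `σ`-weak operator topology on `B(H)`: the coarsest topology for which all the maps
`T ↦ ∑ⱼ ⟪ξⱼ, T ξⱼ⟫`, with `∑ⱼ ‖ξⱼ‖² < ∞`, are continuous. -/
@[reducible] def sigmaWOT : TopologicalSpace (H →L[ℂ] H) :=
  ⨅ ξ : {ξ : ℕ → H // Summable fun j => ‖ξ j‖ ^ 2},
    TopologicalSpace.induced (fun T : H →L[ℂ] H => ∑' j, inner ℂ (ξ.1 j) (T (ξ.1 j)))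
      inferInstance

variable {H}

theorem summable_inner_apply {ξ : ℕ → H} (hξ : Summable fun j => ‖ξ j‖ ^ 2) (T : H →L[ℂ] H) :
    Summable fun j => inner ℂ (ξ j) (T (ξ j)) := by
  refine Summable.of_norm_bounded (hξ.mul_left ‖T‖) fun j => ?_
  calc ‖inner ℂ (ξ j) (T (ξ j))‖ ≤ ‖ξ j‖ * ‖T (ξ j)‖ := norm_inner_le_norm _ _
    _ ≤ ‖ξ j‖ * (‖T‖ * ‖ξ j‖) := by gcongr; exact T.le_opNorm _
    _ = ‖T‖ * ‖ξ j‖ ^ 2 := by ring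

theorem continuous_tsum_inner {ξ : ℕ → H} (hξ : Summable fun j => ‖ξ j‖ ^ 2) :
    Continuous fun T : H →L[ℂ] H => ∑' j, inner ℂ (ξ j) (T (ξ j)) := by
  let L : (H →L[ℂ] H) →ₗ[ℂ] ℂ :=
    { toFun := fun T => ∑' j, inner ℂ (ξ j) (T (ξ j))
      map_add' := fun S T => by
        rw [← (summable_inner_apply hξ S).tsum_add (summable_inner_apply hξ T)]
        simp
      map_smul' := fun c T => by
        simp only [smul_apply, inner_smul_right, RingHom.id_apply,
          smul_eq_mul, tsum_mul_left] }
  refine (L.mkContinuous (∑' j, ‖ξ j‖ ^ 2) fun T => ?_).continuous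
  rw [mul_comm, ← tsum_mul_left]
  refine tsum_of_norm_bounded (hξ.mul_left ‖T‖).hasSum fun j => ?_
  calc ‖inner ℂ (ξ j) (T (ξ j))‖ ≤ ‖ξ j‖ * ‖T (ξ j)‖ := norm_inner_le_norm _ _
    _ ≤ ‖ξ j‖ * (‖T‖ * ‖ξ j‖) := by gcongr; exact T.le_opNorm _
    _ = ‖T‖ * ‖ξ j‖ ^ 2 := by ring

theorem isClosed_of_sigmaWOT {S : Set (H →L[ℂ] H)} (hS : IsClosed[sigmaWOT H] S) :
    IsClosed S := by
  refine IsClosed.mono hS (le_iInf fun ξ => ?_)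
  exact continuous_iff_le_induced.1 (continuous_tsum_inner ξ.2)

end SigmaWeak

/-- A tracial `W*`-algebra with `σ`-weakly separable underlying algebra: a unital `*`-subalgebra
of `B(H)` that is closed in the `σ`-weak operator topology, with a faithful normal trace.
Every isomorphism class of such algebras is represented (with a separable `H`). -/
structure TracialWStar : Type 1 where
  H : Type
  [normedAddCommGroup : NormedAddCommGroup H]
  [innerProductSpace : InnerProductSpace ℂ H]
  [completeSpace : CompleteSpace H]
  S : StarSubalgebra ℂ (H →L[ℂ] H)
  isClosed_sigmaWOT : IsClosed[sigmaWOT H] (S : Set (H →L[ℂ] H))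
  separable : @TopologicalSpace.SeparableSpace S
    (TopologicalSpace.induced (fun a : S => (a : H →L[ℂ] H)) (sigmaWOT H))
  trace : S →ₗ[ℂ] ℂ
  trace_one : trace 1 = 1
  trace_nonneg : ∀ a : S, 0 ≤ trace (star a * a)
  trace_mul_comm : ∀ a b : S, trace (a * b) = trace (b * a)
  trace_faithful : ∀ a : S, trace (star a * a) = 0 → a = 0
  trace_normal : Continuous[TopologicalSpace.induced (fun a : S => (a : H →L[ℂ] H)) (sigmaWOT H),
    inferInstance] trace

namespace TracialWStar

attribute [instance] normedAddCommGroup innerProductSpace completeSpace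

variable (W : TracialWStar)

/-- The underlying algebra, as a `C*`-algebra. -/
def A : Type := W.S

instance : CStarAlgebra W.A :=
  StarSubalgebra.cstarAlgebra W.S (h_closed := isClosed_of_sigmaWOT W.isClosed_sigmaWOT)

/-- The trace `τ`. -/
def τ : W.A →ₗ[ℂ] ℂ := W.trace

/-- The self-adjoint `d`-tuples. -/
abbrev SA (d : ℕ) : Type := Fin d → selfAdjoint W.A

variable {W} {d : ℕ}

/-- The inclusion of self-adjoint tuples in all tuples. -/
def toTuple (X : W.SA d) : Fin d → W.A := fun j => (X j : W.A)

/-- The inner product `⟨Y, Z⟩_τ = ∑ⱼ τ(Yⱼ* Zⱼ)`. -/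
def tinner (Y Z : Fin d → W.A) : ℂ := ∑ j, W.τ (star (Y j) * Z j)

/-- The non-commutative `L^α` norm of a tuple: `(∑ⱼ τ((Yⱼ* Yⱼ)^(α/2)))^(1/α)` for `α < ∞`,
and `maxⱼ ‖Yⱼ‖` for `α = ∞`. -/
def lpNorm (α : ℝ≥0∞) (Y : Fin d → W.A) : ℝ :=
  if α = ∞ then ‖Y‖
  else (∑ j, (W.τ (cfc (fun x : ℝ => x ^ (α.toReal / 2)) (star (Y j) * Y j))).re) ^ (1 / α.toReal)

end TracialWStar

open TracialWStar

/-! ### Non-commutative laws -/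

/-- Non-commutative polynomials `ℂ⟨x₁, …, x_d⟩`, with the words as a basis. -/
abbrev NCPoly (d : ℕ) : Type := MonoidAlgebra ℂ (FreeMonoid (Fin d))

namespace NCPoly

variable {d : ℕ}

/-- The conjugate-linear involution reversing words, so that `xⱼ* = xⱼ`. -/
def conjStar (p : NCPoly d) : NCPoly d :=
  p.coeff.sum fun w c => MonoidAlgebra.single (star w) (starRingEnd ℂ c)

/-- Evaluation `p ↦ p(X)`. -/
def eval {A : Type*} [Ring A] [Algebra ℂ A] (X : Fin d → A) : NCPoly d →ₐ[ℂ] A :=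
  MonoidAlgebra.lift ℂ A (FreeMonoid (Fin d)) (FreeMonoid.lift X)

end NCPoly

/-- Non-commutative laws: unital, positive, tracial, exponentially bounded functionals. -/
structure IsNCLaw {d : ℕ} (μ : NCPoly d →ₗ[ℂ] ℂ) : Prop where
  unital : μ 1 = 1
  positive : ∀ p, 0 ≤ μ (NCPoly.conjStar p * p)
  tracial : ∀ p q, μ (p * q) = μ (q * p)
  exp_bounded : ∃ R : ℝ, 0 < R ∧ ∀ w : FreeMonoid (Fin d),
    ‖μ (MonoidAlgebra.single w 1)‖ ≤ R ^ w.length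

/-- The law `p ↦ τ(p(X))` of a self-adjoint tuple. -/
def law {W : TracialWStar} {d : ℕ} (X : W.SA d) : NCPoly d →ₗ[ℂ] ℂ :=
  W.τ ∘ₗ (NCPoly.eval (toTuple X)).toLinearMap

/-! ### Trace polynomials -/

/-- A formal product `tr(p₁) ⋯ tr(pₙ) p₀` of words. -/
structure TraceMonomial (ι : Type) where
  traced : List (FreeMonoid ι)
  word : FreeMonoid ι

namespace TraceMonomial

variable {ι : Type}

def eval {W : TracialWStar} (X : ι → W.A) (m : TraceMonomial ι) : W.A :=
  (m.traced.map fun w => W.τ (FreeMonoid.lift X w)).prod • FreeMonoid.lift X m.word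

/-- The total number of occurrences of variables satisfying `s`. -/
def degree (s : ι → Bool) (m : TraceMonomial ι) : ℕ :=
  (m.traced.map fun w => w.toList.countP s).sum + m.word.toList.countP s

end TraceMonomial

/-- Trace polynomials: formal linear combinations of trace monomials. (The relations of the
abstract algebra, such as `tr(pq) = tr(qp)`, hold after evaluation, and only evaluations are
used.) -/
abbrev TracePoly (ι : Type) : Type := TraceMonomial ι →₀ ℂ

def TracePoly.eval {ι : Type} {W : TracialWStar} (X : ι → W.A) (g : TracePoly ι) : W.A :=
  g.sum fun m c => c • m.eval X

/-- The variables `x₁, …, x_d` and the blocks `yᵢ = (y_{i,1}, …, y_{i,d})`, for `i < ℓ`. -/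
abbrev FormVar (d ℓ : ℕ) : Type := Fin d ⊕ (Fin ℓ × Fin d)

/-- Being multilinear in the blocks `y₁, …, y_ℓ`: each term has degree one in each block. -/
def TracePoly.IsMultilinear {d ℓ : ℕ} (g : TracePoly (FormVar d ℓ)) : Prop :=
  ∀ m ∈ g.support, ∀ i : Fin ℓ,
    m.degree (Sum.elim (fun _ => false) (fun p => decide (p.1 = i))) = 1

/-! ### Non-commutative functions -/

/-- Families `(f^{A,τ})` of maps `(X, Y₁, …, Y_ℓ) ↦ f(X)[Y₁, …, Y_ℓ]` from self-adjoint
`d`-tuples to `d'`-tuples. -/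
abbrev NCForm (d ℓ d' : ℕ) : Type 1 :=
  ∀ W : TracialWStar, W.SA d → (Fin ℓ → W.SA d) → (Fin d' → W.A)

/-- Families `(f^{A,τ})` of maps `A_sa^d → A`. -/
abbrev NCFun (d : ℕ) : Type 1 := ∀ W : TracialWStar, W.SA d → W.A

/-- Families `(f^{A,τ})` of maps `A_sa^d → A_sa^d'`. -/
abbrev NCVec (d d' : ℕ) : Type 1 := ∀ W : TracialWStar, W.SA d → W.SA d'

/-- The function defined by a tuple of trace polynomials. -/
def tracePolyForm {d ℓ d' : ℕ} (g : Fin d' → TracePoly (FormVar d ℓ)) : NCForm d ℓ d' :=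
  fun _ X Y j => (g j).eval (Sum.elim (toTuple X) fun p => toTuple (Y p.1) p.2)

/-- The complex-multilinear extension to `A^d × ⋯ × A^d` of a real-multilinear map on
`A_sa^d × ⋯ × A_sa^d`, by expanding `Yᵢ = Re Yᵢ + i Im Yᵢ`. -/
def complexify {W : TracialWStar} {d ℓ d' : ℕ} (Λ : (Fin ℓ → W.SA d) → (Fin d' → W.A))
    (Y : Fin ℓ → Fin d → W.A) : Fin d' → W.A :=
  ∑ s : Finset (Fin ℓ), (Complex.I ^ s.card) •
    Λ fun i j => if i ∈ s then imaginaryPart (Y i j) else realPart (Y i j)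

/-- The norm `‖Λ‖_{𝓜^ℓ,tr}`: the supremum of the norms `‖Λ‖_{α;β₁,…,β_ℓ}` of the complexified
form over all exponents in `[1,∞]` with `1/α = 1/β₁ + ⋯ + 1/β_ℓ`. -/
def formNorm {W : TracialWStar} {d ℓ d' : ℕ} (Λ : (Fin ℓ → W.SA d) → (Fin d' → W.A)) : ℝ≥0∞ :=
  ⨆ (α : ℝ≥0∞) (β : Fin ℓ → ℝ≥0∞) (_ : 1 ≤ α) (_ : ∀ i, 1 ≤ β i) (_ : α⁻¹ = ∑ i, (β i)⁻¹)
    (Y : Fin ℓ → Fin d → W.A) (_ : ∀ i, lpNorm (β i) (Y i) ≤ 1),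
      ENNReal.ofReal (lpNorm α (complexify Λ Y))

/-- The seminorm of radius `R`: the supremum over all tracial `W*`-algebras and all
self-adjoint `X` with `‖X‖_∞ ≤ R`. -/
def ctrNorm {d ℓ d' : ℕ} (R : ℝ) (f : NCForm d ℓ d') : ℝ≥0∞ :=
  ⨆ (W : TracialWStar) (X : W.SA d) (_ : ‖toTuple X‖ ≤ R), formNorm (f W X)

/-- The norm of `BC_tr`: the supremum of the seminorms over all radii. -/
def bcNorm {d ℓ d' : ℕ} (f : NCForm d ℓ d') : ℝ≥0∞ := ⨆ R : ℝ, ctrNorm R f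

/-- The space `C_tr(ℝ^{*d}, 𝓜^ℓ(ℝ^{*d}))^{d'}`. -/
structure IsCtr {d ℓ d' : ℕ} (f : NCForm d ℓ d') : Prop where
  multilinear : ∀ (W : TracialWStar) (X : W.SA d),
    ∃ M : MultilinearMap ℝ (fun _ : Fin ℓ => W.SA d) (Fin d' → W.A), ∀ Y, f W X Y = M Y
  approx : ∀ R : ℝ, 0 < R → ∀ ε : ℝ, 0 < ε → ∃ g : Fin d' → TracePoly (FormVar d ℓ),
    (∀ j, (g j).IsMultilinear) ∧ ctrNorm R (f - tracePolyForm g) < ENNReal.ofReal ε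

/-- The space `C_tr^k(ℝ^{*d})`: the iterated directional derivatives of order `n ≤ k` exist
(in norm) and are given by functions `F n` in `C_tr(ℝ^{*d}, 𝓜^n)`. -/
def IsCtrK {d : ℕ} (k : ℕ∞) (f : NCFun d) : Prop :=
  ∃ F : ∀ n : ℕ, NCForm d n 1,
    (∀ W X Y, F 0 W X Y = fun _ => f W X) ∧
    (∀ n : ℕ, (n : ℕ∞) ≤ k → IsCtr (F n)) ∧
    ∀ n : ℕ, ((n + 1 : ℕ) : ℕ∞) ≤ k → ∀ (W : TracialWStar) (X : W.SA d) (Y : Fin n → W.SA d)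
      (Z : W.SA d),
      HasDerivAt (fun t : ℝ => F n W (X + t • Z) Y) (F (n + 1) W X (Fin.snoc Y Z)) 0

/-- `tr(f)`, as a function with values in the multiples of `1`. -/
def trFun {d : ℕ} (f : NCFun d) : NCFun d := fun W X => algebraMap ℂ W.A (W.τ (f W X))

/-- The self-adjoint elements of `tr(C_tr^k(ℝ^{*d}))`. -/
def IsTrCtrKSelfAdjoint {d : ℕ} (k : ℕ∞) (φ : NCFun d) : Prop :=
  (∃ f : NCFun d, IsCtrK k f ∧ φ = trFun f) ∧ ∀ W X, IsSelfAdjoint (φ W X)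

/-- `G` is the gradient of the (real scalar valued) `φ` at `X`: for all self-adjoint `Y`,
`∂φ(X)[Y] = ⟨Y, G⟩_τ`. -/
def IsGradientAt {d : ℕ} (φ : NCFun d) (W : TracialWStar) (X G : W.SA d) : Prop :=
  ∀ Y : W.SA d, HasDerivAt (fun t : ℝ => φ W (X + t • Y))
    (algebraMap ℂ W.A (tinner (toTuple Y) (toTuple G))) 0

open Classical in
/-- The gradient `∇φ`. The tuple in `IsGradientAt` is unique if it exists, since `τ` is
faithful. -/
def ncGradient {d : ℕ} (φ : NCFun d) : NCVec d d := fun W X =>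
  if h : ∃ G, IsGradientAt φ W X G then h.choose else 0

/-- The derivative `∂f(X)[Y]` of `f`, as a form with one argument. -/
def derivForm {d d' : ℕ} (f : NCVec d d') : NCForm d 1 d' := fun W X Y =>
  deriv (fun t : ℝ => toTuple (f W (X + t • Y 0))) 0

/-- The identity form `Id(X)[Y] = Y`. -/
def idForm (d : ℕ) : NCForm d 1 d := fun _ _ Y => toTuple (Y 0)

/-- The function `⟨f, g⟩_tr`. -/
def trInnerFun {d d' : ℕ} (f g : NCVec d d') : NCFun d := fun W X =>
  algebraMap ℂ W.A (tinner (toTuple (f W X)) (toTuple (g W X)))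

/-! ### Evaluation on laws, push-forward, and the coupling distance -/

open Classical in
/-- The evaluation `μ̃(f)` of a scalar-valued function at a law `μ`: the value of `f` at
a self-adjoint tuple of law `μ`. For `f` in `tr(C_tr(ℝ^{*d}))` it does not depend on
the tuple. -/
def lawEval {d : ℕ} (μ : NCPoly d →ₗ[ℂ] ℂ) (f : NCFun d) : ℂ :=
  if h : ∃ r : Σ W : TracialWStar, W.SA d, law r.2 = μ
  then h.choose.1.τ (f h.choose.1 h.choose.2) else 0

open Classical in
/-- The push-forward `f_* μ`: the law of `f(X)` for a self-adjoint tuple `X` of law `μ`.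
For `f` in `C_tr(ℝ^{*d})_sa^{d'}` it does not depend on the tuple. -/
def pushforward {d d' : ℕ} (f : NCVec d d') (μ : NCPoly d →ₗ[ℂ] ℂ) : NCPoly d' →ₗ[ℂ] ℂ :=
  if h : ∃ r : Σ W : TracialWStar, W.SA d, law r.2 = μ
  then law (f h.choose.1 h.choose.2) else 0

/-- The `L²` coupling distance (non-commutative `L²` Wasserstein distance) of two laws. -/
def couplingDist {d : ℕ} (μ ν : NCPoly d →ₗ[ℂ] ℂ) : ℝ :=
  sInf {r : ℝ | ∃ (W : TracialWStar) (X Y : W.SA d),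
    law X = μ ∧ law Y = ν ∧ r = lpNorm 2 (toTuple X - toTuple Y)}

/-- `X` and `Y` are an optimal coupling of `μ` and `ν`. -/
def IsOptimalCoupling {d : ℕ} {W : TracialWStar} (X Y : W.SA d) (μ ν : NCPoly d →ₗ[ℂ] ℂ) : Prop :=
  law X = μ ∧ law Y = ν ∧ lpNorm 2 (toTuple X - toTuple Y) = couplingDist μ ν

end

/-!
# Gradients of uniformly convex trace functions are optimal couplings

The proof is the non-commutative version of the classical one: if `∇φ` is the gradient of a convex
function, then `X` and `∇φ(X)` maximize `Re ⟨X', Y'⟩_τ` among all couplings of their laws. The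
Legendre transform of `φ` is not needed. Let `X'`, `Y'` in some algebra have the laws of `X` and
`∇φ(X)`. If `Y' = ∇φ(Z)`, where `Z` has the law of `X`, then `φ(X') = φ(Z)`, because `φ` depends on
laws only, and the first order convexity inequality
`φ(X') ≥ φ(Z) + Re ⟨X' - Z, ∇φ(Z)⟩_τ` (`add_tinner_le_of_isGradientAt`) becomes
`Re ⟨X', Y'⟩_τ ≤ Re ⟨Z, Y'⟩_τ = Re ⟨X, ∇φ(X)⟩_τ` (`IsConvexGradient.tinner_le`). As the `L²`-norms
of `X'` and `Y'` are fixed by the laws, this is optimality.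

The bound `‖∂∇φ - K Id‖ < K` is used twice. For the exponent `2` it says that `∂∇φ` is positive, so
that `φ` is convex. For the exponent `∞` it makes `Z ↦ Z - K⁻¹ (∇φ(Z) - Y')` a contraction in
operator norm (`contractingWith_solveStep`), which yields `Z`. To compare `Z` with `X`, one works in
a closed algebra `B` of pairs of elements of the two algebras with equal traces (`IsMatching`). Such
a `B` containing `(∇φ(X), Y')` exists since these tuples have the same law; it is preserved by trace
polynomials and hence by `∇φ`, and so it contains all the iterates started from `(0, 0)` and their
limit `(X, Z)` (`IsConvexGradient.exists_preimage`).

That `∇φ` exists, is a locally uniform limit of trace polynomials, and has directional derivatives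
in operator norm follows from the duality of `L¹` and `L^∞` (`norm_le_of_norm_τ_mul_le`): the
approximation of `∂f` and `∂²f` by trace polynomials, for the exponent `1` in the first argument,
forces the elements representing `Y ↦ τ(∂f(X)[Y])` and `Y ↦ τ(∂²f(X)[Y, Z])` to be operator norm
limits of trace polynomials (`IsCtr.exists_tinner`).

Finally, every law is the law of some tuple, by the Gelfand–Naimark–Segal construction
(`IsNCLaw.exists_law_eq`). The commutant of the right multiplications serves as the von Neumann
algebra; its trace property follows from `J T Ω = T* Ω`, where `J p = p*`, without the commutation
theorem.
-/

noncomputable section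

open TracialWStar

/-! ### The trace and the duality of `L¹` and `L^∞` -/

namespace TracialWStar

variable {W : TracialWStar} {d : ℕ}

theorem τ_one : W.τ 1 = 1 := W.trace_one

theorem τ_star_mul_self_nonneg (a : W.A) : 0 ≤ W.τ (star a * a) := W.trace_nonneg a

theorem τ_mul_comm (a b : W.A) : W.τ (a * b) = W.τ (b * a) := W.trace_mul_comm a b

theorem eq_zero_of_τ_star_mul_self {a : W.A} (h : W.τ (star a * a) = 0) : a = 0 :=
  W.trace_faithful a h

theorem τ_sq_nonneg {a : W.A} (ha : IsSelfAdjoint a) : 0 ≤ W.τ (a * a) := by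
  simpa [ha.star_eq] using τ_star_mul_self_nonneg a

theorem τ_im_of_isSelfAdjoint {a : W.A} (ha : IsSelfAdjoint a) : (W.τ a).im = 0 := by
  -- polarization: `4a = (a + 1)² - (a - 1)²`
  have h1 := τ_sq_nonneg (ha.add (IsSelfAdjoint.one W.A))
  have h2 := τ_sq_nonneg (ha.sub (IsSelfAdjoint.one W.A))
  have h3 : W.τ ((a + 1) * (a + 1)) - W.τ ((a - 1) * (a - 1)) = 4 * W.τ a := by
    rw [← map_sub]
    have : (a + 1) * (a + 1) - (a - 1) * (a - 1) = (4 : ℂ) • a := by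
      simp only [add_mul, mul_add, sub_mul, mul_sub, mul_one, one_mul]
      module
    rw [this, map_smul, smul_eq_mul]
  have h4 := congrArg Complex.im h3
  rw [Complex.sub_im, ← (Complex.le_def.1 h1).2, ← (Complex.le_def.1 h2).2] at h4
  simp at h4
  exact h4

theorem τ_star (a : W.A) : W.τ (star a) = starRingEnd ℂ (W.τ a) := by
  have h1 := τ_im_of_isSelfAdjoint (realPart a).2
  have h2 := τ_im_of_isSelfAdjoint (imaginaryPart a).2
  have e1 : a = (realPart a : W.A) + Complex.I • (imaginaryPart a : W.A) :=
    (realPart_add_I_smul_imaginaryPart a).symm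
  have e2 : star a = (realPart a : W.A) - Complex.I • (imaginaryPart a : W.A) := by
    conv_lhs => rw [e1]
    simp [sub_eq_add_neg]
  rw [e2]
  conv_rhs => rw [e1]
  apply Complex.ext <;> simp [h1, h2]

/-- The inner product `tinner` makes the space of tuples a pre-Hilbert space. -/
@[reducible] def tinnerCore (W : TracialWStar) (d : ℕ) :
    PreInnerProductSpace.Core ℂ (Fin d → W.A) where
  inner := tinner
  conj_inner_symm Y Z := by
    simp only [tinner, map_sum]
    refine Finset.sum_congr rfl fun j _ => ?_
    rw [← τ_star, star_mul, star_star]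
  re_inner_nonneg Y := by
    simp only [tinner, map_sum]
    exact Finset.sum_nonneg fun j _ => (Complex.le_def.1 (τ_star_mul_self_nonneg _)).1
  add_left X Y Z := by
    simp [tinner, add_mul, Finset.sum_add_distrib]
  smul_left X Y c := by
    simp [tinner, Finset.mul_sum]

theorem tinner_self_nonneg (Y : Fin d → W.A) : 0 ≤ (tinner Y Y).re :=
  (tinnerCore W d).re_inner_nonneg Y

theorem conj_tinner (Y Z : Fin d → W.A) : starRingEnd ℂ (tinner Z Y) = tinner Y Z :=
  (tinnerCore W d).conj_inner_symm Y Z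

theorem norm_tinner_le (Y Z : Fin d → W.A) :
    ‖tinner Y Z‖ ≤ √(tinner Y Y).re * √(tinner Z Z).re :=
  @InnerProductSpace.Core.norm_inner_le_norm ℂ _ _ _ _ (tinnerCore W d) Y Z

theorem tinner_sub_right (X Y Z : Fin d → W.A) : tinner X (Y - Z) = tinner X Y - tinner X Z := by
  simp [tinner, mul_sub, Finset.sum_sub_distrib]

theorem tinner_sub_left (X Y Z : Fin d → W.A) : tinner (X - Y) Z = tinner X Z - tinner Y Z := by
  simp [tinner, sub_mul, Finset.sum_sub_distrib]

theorem tinner_smul_right (c : ℝ) (Y Z : Fin d → W.A) : tinner Y (c • Z) = c * tinner Y Z := by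
  simp [tinner, Finset.mul_sum]

theorem tinner_smul_left (c : ℝ) (Y Z : Fin d → W.A) : tinner (c • Y) Z = c * tinner Y Z := by
  simp [tinner, Finset.mul_sum]

theorem tinner_sub_sub_self_re (Y Z : Fin d → W.A) :
    (tinner (Y - Z) (Y - Z)).re = (tinner Y Y).re - 2 * (tinner Y Z).re + (tinner Z Z).re := by
  have : (tinner Z Y).re = (tinner Y Z).re := by rw [← conj_tinner]; simp
  simp only [tinner_sub_left, tinner_sub_right, Complex.sub_re, this]
  ring

theorem eq_zero_of_tinner_self {Y : Fin d → W.A} (h : (tinner Y Y).re = 0) : Y = 0 := by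
  funext j
  apply eq_zero_of_τ_star_mul_self
  have h0 : ∀ i ∈ Finset.univ, 0 ≤ (W.τ (star (Y i) * Y i)).re :=
    fun i _ => (Complex.le_def.1 (τ_star_mul_self_nonneg _)).1
  rw [tinner, Complex.re_sum] at h
  apply Complex.ext
  · exact (Finset.sum_eq_zero_iff_of_nonneg h0).1 h j (Finset.mem_univ _)
  · exact (Complex.le_def.1 (τ_star_mul_self_nonneg _)).2.symm

theorem cfc_mul_self_eq {a : W.A} {f g : ℝ → ℝ} (hf : ContinuousOn f (spectrum ℝ a))
    (h : ∀ x ∈ spectrum ℝ a, f x * f x = g x) : cfc f a * cfc f a = cfc g a := by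
  rw [← cfc_mul f f a hf hf]
  exact cfc_congr h

/-- `‖u‖² - u* u` is a square. -/
theorem exists_sq_add_star_mul_self (u : W.A) : ∃ v : W.A, IsSelfAdjoint v ∧
    v * v + star u * u = algebraMap ℝ W.A (‖u‖ ^ 2) := by
  have hs : IsSelfAdjoint (star u * u) := IsSelfAdjoint.star_mul_self u
  refine ⟨cfc (fun x : ℝ => √(‖u‖ ^ 2 - x)) (star u * u), cfc_predicate _ _, ?_⟩
  have hle : ∀ x ∈ spectrum ℝ (star u * u), x ≤ ‖u‖ ^ 2 := fun x hx => by
    have := (norm_cfc_le_iff (fun x : ℝ => x) (star u * u) (norm_nonneg (star u * u))).1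
      (by rw [cfc_id' ℝ (star u * u)]) x hx
    rw [CStarRing.norm_star_mul_self, ← sq] at this
    exact (le_abs_self x).trans this
  rw [cfc_mul_self_eq (g := fun x => ‖u‖ ^ 2 - x) (by fun_prop)
    fun x hx => Real.mul_self_sqrt (sub_nonneg.2 (hle x hx)),
    cfc_sub (fun _ => ‖u‖ ^ 2) (fun x => x) (star u * u), cfc_id' ℝ (star u * u), cfc_const _ _ hs]
  abel

/-- `|τ(u b)| ≤ ‖u‖ τ(b)` for the positive element `b = c* c`. -/
theorem norm_τ_mul_star_mul_self_le (u c : W.A) :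
    ‖W.τ (u * (star c * c))‖ ≤ ‖u‖ * (W.τ (star c * c)).re := by
  set t := (W.τ (star c * c)).re with ht
  have ht0 : 0 ≤ t := (Complex.le_def.1 (τ_star_mul_self_nonneg _)).1
  have h1 := norm_tinner_le (fun _ : Fin 1 => star c) (fun _ => u * star c)
  simp only [tinner, Finset.univ_unique, Finset.sum_singleton, star_star] at h1
  have e1 : W.τ (c * (u * star c)) = W.τ (u * (star c * c)) := by
    rw [τ_mul_comm, mul_assoc]
  have e2 : W.τ (c * star c) = W.τ (star c * c) := τ_mul_comm _ _
  rw [e1, e2] at h1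
  have h2 : (W.τ (star (u * star c) * (u * star c))).re ≤ ‖u‖ ^ 2 * t := by
    obtain ⟨v, hv, hvu⟩ := exists_sq_add_star_mul_self u
    have h3 := (Complex.le_def.1 (τ_star_mul_self_nonneg (v * star c))).1
    have h4 : star (v * star c) * (v * star c) + star (u * star c) * (u * star c) =
        (‖u‖ ^ 2) • (c * star c) := by
      simp only [star_mul, star_star, hv.star_eq]
      calc c * v * (v * star c) + c * star u * (u * star c)
          = c * (v * v + star u * u) * star c := by noncomm_ring
        _ = _ := by rw [hvu, ← Algebra.commutes, mul_assoc, Algebra.smul_def]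
    have h5 := congrArg (fun x => (W.τ x).re) h4
    simp only [map_add, Complex.add_re] at h5
    have h6 : (W.τ ((‖u‖ ^ 2) • (c * star c))).re = ‖u‖ ^ 2 * t := by
      rw [LinearMap.map_smul_of_tower, e2, Complex.smul_re, smul_eq_mul]
    rw [h6] at h5
    simp only [Complex.zero_re] at h3
    linarith
  calc _ ≤ √t * √(‖u‖ ^ 2 * t) := h1.trans (by gcongr)
    _ = _ := by
      rw [Real.sqrt_mul (sq_nonneg _), Real.sqrt_sq (norm_nonneg _)]
      linear_combination ‖u‖ * Real.mul_self_sqrt ht0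

theorem norm_τ_le (a : W.A) : ‖W.τ a‖ ≤ ‖a‖ := by
  simpa [τ_one] using norm_τ_mul_star_mul_self_le a 1

theorem continuous_τ : Continuous W.τ :=
  AddMonoidHomClass.continuous_of_bound W.τ 1 fun a => by simpa using norm_τ_le a

/-- The trace as a continuous linear functional. -/
def τCLM (W : TracialWStar) : W.A →L[ℂ] ℂ := ⟨W.τ, continuous_τ⟩

/-- `|τ(a)| ≤ τ(|a|)`, by an approximate polar decomposition `a = u (|a| + ε)`, `‖u‖ ≤ 1`. -/
theorem norm_τ_le_τ_abs (a : W.A) :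
    ‖W.τ a‖ ≤ (W.τ (cfc (fun x : ℝ => √x) (star a * a))).re := by
  have hs : IsSelfAdjoint (star a * a) := IsSelfAdjoint.star_mul_self a
  have hnn : ∀ x ∈ spectrum ℝ (star a * a), 0 ≤ x := fun x hx =>
    spectrum_star_mul_self_nonneg x hx
  refine le_of_forall_pos_le_add fun ε hε => ?_
  have hpos : ∀ x : ℝ, 0 < √x + ε := fun x => by positivity
  set r : ℝ → ℝ := fun x => (√x + ε)⁻¹ with hr
  have hrc : Continuous r := by
    refine Continuous.inv₀ (by fun_prop) fun x => (hpos x).ne'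
  set u := a * cfc r (star a * a) with hu
  set c := cfc (fun x : ℝ => √(√x + ε)) (star a * a) with hc
  have hcs : star c = c := (cfc_predicate _ _ : IsSelfAdjoint c).star_eq
  have hcc : c * c = cfc (fun x : ℝ => √x + ε) (star a * a) :=
    cfc_mul_self_eq (by fun_prop) fun x _ => Real.mul_self_sqrt (hpos x).le
  have hcc' : c * c = cfc (fun x : ℝ => √x) (star a * a) + algebraMap ℝ W.A ε := by
    rw [hcc, cfc_add_const _ _ _ (by fun_prop) hs]
  have hua : u * (star c * c) = a := by
    rw [hcs, hcc, hu, mul_assoc, ← cfc_mul r _ _ (by fun_prop) (by fun_prop)]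
    have : cfc (fun x => r x * (√x + ε)) (star a * a) = cfc (fun _ : ℝ => (1 : ℝ)) (star a * a) :=
      cfc_congr fun x _ => inv_mul_cancel₀ (hpos x).ne'
    rw [this, cfc_const_one ℝ _ hs, mul_one]
  have hu1 : ‖u‖ ≤ 1 := by
    have h1 : star u * u = cfc (fun x => r x * x * r x) (star a * a) := by
      have h2 : star (cfc r (star a * a)) = cfc r (star a * a) :=
        (cfc_predicate _ _ : IsSelfAdjoint (cfc r (star a * a))).star_eq
      rw [cfc_mul (fun x => r x * x) r _ (by fun_prop) (by fun_prop),
        cfc_mul r (fun x => x) _ (by fun_prop) (by fun_prop), cfc_id' ℝ (star a * a), hu,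
        star_mul, h2]
      noncomm_ring
    have h3 : ‖u‖ * ‖u‖ ≤ 1 := by
      rw [← CStarRing.norm_star_mul_self, h1]
      refine norm_cfc_le zero_le_one fun x hx => ?_
      have hx0 := hnn x hx
      have h4 : r x * x * r x = (√x * r x) ^ 2 := by
        rw [mul_pow, Real.sq_sqrt hx0]; ring
      have h5 : √x * r x ≤ 1 := by
        rw [hr, ← div_eq_mul_inv, div_le_one (hpos x)]; linarith
      have h6 : 0 ≤ √x * r x := mul_nonneg (Real.sqrt_nonneg _) (inv_nonneg.2 (hpos x).le)
      rw [h4, Real.norm_of_nonneg (sq_nonneg _)]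
      exact pow_le_one₀ h6 h5
    nlinarith [norm_nonneg u]
  have key := norm_τ_mul_star_mul_self_le u c
  have h0 : 0 ≤ (W.τ (star c * c)).re := (Complex.le_def.1 (τ_star_mul_self_nonneg _)).1
  rw [hua] at key
  refine key.trans ((mul_le_of_le_one_left h0 hu1).trans (le_of_eq ?_))
  rw [hcs, hcc', map_add, Complex.add_re, Algebra.algebraMap_eq_smul_one,
    LinearMap.map_smul_of_tower, τ_one]
  simp

/-- If `τ(b a) ≤ C τ(b)` for all positive `b`, then `a ≤ C`: for `b = (a - C)⁺` the hypothesis says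
`τ(b²) ≤ 0`, so that `b = 0` by faithfulness. -/
theorem spectrum_le_of_τ_mul_le {a : W.A} (ha : IsSelfAdjoint a) {C : ℝ}
    (h : ∀ c : W.A, IsSelfAdjoint c → (W.τ (c * c * a)).re ≤ C * (W.τ (c * c)).re) :
    ∀ x ∈ spectrum ℝ a, x ≤ C := by
  set p := cfc (fun x : ℝ => max 0 (x - C)) a with hp
  have hps : IsSelfAdjoint p := cfc_predicate _ _
  set c := cfc (fun x : ℝ => √(max 0 (x - C))) a with hc
  have hcc : c * c = p := cfc_mul_self_eq (by fun_prop)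
    fun x _ => Real.mul_self_sqrt (le_max_left _ _)
  have hpp : p * p = p * a - C • p := by
    have e1 : p * a = cfc (fun x : ℝ => max 0 (x - C) * x) a := by
      rw [cfc_mul _ (fun x => x) _ (by fun_prop) (by fun_prop), cfc_id' ℝ a]
    have e2 : C • p = cfc (fun x : ℝ => C • max 0 (x - C)) a := by
      rw [cfc_smul C _ _ (by fun_prop)]
    rw [e1, e2, ← cfc_sub _ _ _ (by fun_prop) (by fun_prop)]
    refine cfc_mul_self_eq (by fun_prop) fun x _ => ?_
    rcases max_cases 0 (x - C) with ⟨h, _⟩ | ⟨h, _⟩ <;> rw [h] <;> simp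
    ring
  have h1 := h c (cfc_predicate _ _)
  rw [hcc] at h1
  have h2 : (W.τ (p * p)).re ≤ 0 := by
    rw [hpp, map_sub, Complex.sub_re, LinearMap.map_smul_of_tower, Complex.smul_re, smul_eq_mul]
    linarith
  have h3 := τ_sq_nonneg hps
  have h4 : p = 0 := by
    refine eq_zero_of_τ_star_mul_self ?_
    rw [hps.star_eq]
    exact Complex.ext (le_antisymm h2 (Complex.le_def.1 h3).1) (Complex.le_def.1 h3).2.symm
  intro x hx
  have h5 := (norm_cfc_le_iff (fun x : ℝ => max 0 (x - C)) a (c := 0) le_rfl (by fun_prop) ha).1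
    (by rw [← hp, h4, norm_zero]) x hx
  have h6 := (le_abs_self _).trans h5
  have := (le_max_right 0 (x - C)).trans h6
  linarith

theorem norm_le_of_isSelfAdjoint_of_norm_τ_le {a : W.A} (ha : IsSelfAdjoint a) {C : ℝ} (hC : 0 ≤ C)
    (h : ∀ c : W.A, IsSelfAdjoint c → |(W.τ (c * c * a)).re| ≤ C * (W.τ (c * c)).re) :
    ‖a‖ ≤ C := by
  have h1 := spectrum_le_of_τ_mul_le ha fun c hc => (le_abs_self _).trans (h c hc)
  have h2 := spectrum_le_of_τ_mul_le (C := C) ha.neg fun c hc => by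
    rw [mul_neg, map_neg, Complex.neg_re]; exact (neg_le_abs _).trans (h c hc)
  rw [← cfc_id' ℝ a]
  refine norm_cfc_le hC fun x hx => abs_le.2 ⟨?_, h1 x hx⟩
  have := h2 (-x) (by rw [← spectrum.neg_eq]; simpa using hx)
  linarith

/-- A quantitative form of the duality of `L¹` and `L^∞`: testing against positive elements
controls the operator norm. The factor `2` comes from splitting `a` into its real and imaginary
parts. -/
theorem norm_le_of_norm_τ_mul_le {a : W.A} {C : ℝ} (hC : 0 ≤ C)
    (h : ∀ c : W.A, IsSelfAdjoint c → ‖W.τ (c * c * a)‖ ≤ C * (W.τ (c * c)).re) :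
    ‖a‖ ≤ 2 * C := by
  have e1 : a = (realPart a : W.A) + Complex.I • (imaginaryPart a : W.A) :=
    (realPart_add_I_smul_imaginaryPart a).symm
  have him : ∀ c b : W.A, IsSelfAdjoint c → IsSelfAdjoint b → (W.τ (c * c * b)).im = 0 := by
    intro c b hc hb
    rw [τ_mul_comm, ← mul_assoc, τ_mul_comm, ← mul_assoc]
    refine τ_im_of_isSelfAdjoint ?_
    rw [IsSelfAdjoint, star_mul, star_mul, hc.star_eq, hb.star_eq, mul_assoc]
  have hre : ∀ c : W.A, IsSelfAdjoint c → (W.τ (c * c * realPart a)).re = (W.τ (c * c * a)).re ∧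
      (W.τ (c * c * imaginaryPart a)).re = (W.τ (c * c * a)).im := by
    intro c hc
    have h1 := him c _ hc (realPart a).2
    have h2 := him c _ hc (imaginaryPart a).2
    have h3 : W.τ (c * c * a) = W.τ (c * c * realPart a) +
        Complex.I * W.τ (c * c * imaginaryPart a) := by
      conv_lhs => rw [e1]
      rw [mul_add, map_add, mul_smul_comm, map_smul, smul_eq_mul]
    rw [h3]
    constructor <;> simp [h1, h2]
  have n1 : ‖(realPart a : W.A)‖ ≤ C := norm_le_of_isSelfAdjoint_of_norm_τ_le (realPart a).2 hC
    fun c hc => by rw [(hre c hc).1]; exact (Complex.abs_re_le_norm _).trans (h c hc)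
  have n2 : ‖(imaginaryPart a : W.A)‖ ≤ C :=
    norm_le_of_isSelfAdjoint_of_norm_τ_le (imaginaryPart a).2 hC
    fun c hc => by rw [(hre c hc).2]; exact (Complex.abs_im_le_norm _).trans (h c hc)
  rw [e1]
  refine (norm_add_le _ _).trans ?_
  rw [norm_smul, Complex.norm_I, one_mul]
  linarith

/-! ### The exponents `1`, `2`, `∞` -/

theorem lpNorm_top (Y : Fin d → W.A) : lpNorm ∞ Y = ‖Y‖ := if_pos rfl

theorem lpNorm_two (Y : Fin d → W.A) : lpNorm 2 Y = √(tinner Y Y).re := by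
  rw [lpNorm, if_neg (by simp), Real.sqrt_eq_rpow, tinner, Complex.re_sum]
  simp [cfc_id']

theorem lpNorm_one (Y : Fin d → W.A) :
    lpNorm 1 Y = ∑ j, (W.τ (cfc (fun x : ℝ => √x) (star (Y j) * Y j))).re := by
  rw [lpNorm, if_neg (by simp)]
  simp [Real.sqrt_eq_rpow]

theorem lpNorm_one_single (j : Fin d) {c : W.A} (hc : IsSelfAdjoint c) :
    lpNorm 1 (Pi.single j (c * c) : Fin d → W.A) = (W.τ (c * c)).re := by
  rw [lpNorm_one, Finset.sum_eq_single j]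
  · have h1 : star (c * c) * (c * c) = cfc (fun x : ℝ => x ^ 4) c := by
      rw [cfc_pow_id c 4, star_mul, hc.star_eq]; noncomm_ring
    have h2 : c * c = cfc (fun x : ℝ => x ^ 2) c := by
      rw [cfc_pow_id c 2, sq]
    rw [Pi.single_eq_same, h1, ← cfc_comp' _ _ _ (by fun_prop) (by fun_prop) hc, h2]
    congr 3
    funext x
    rw [show x ^ 4 = (x ^ 2) ^ 2 by ring, Real.sqrt_sq (sq_nonneg x)]
  · intro i _ hi
    rw [Pi.single_eq_of_ne hi]
    have : cfc (fun x : ℝ => √x) (star (0 : W.A) * 0) = 0 := by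
      rw [mul_zero, cfc_apply_zero]; simp
    rw [this]; simp
  · simp

end TracialWStar

/-! ### Representation of functionals by elements of the algebra -/

namespace TracialWStar

variable {W : TracialWStar} {d : ℕ}

theorem norm_τ_sq_mul_le {c : W.A} (hc : IsSelfAdjoint c) (a : W.A) :
    ‖W.τ (c * c * a)‖ ≤ ‖a‖ * (W.τ (c * c)).re := by
  have := norm_τ_mul_star_mul_self_le a c
  rwa [hc.star_eq, τ_mul_comm] at this

theorem eq_zero_of_τ_sq_re {c : W.A} (hc : IsSelfAdjoint c) (h : (W.τ (c * c)).re = 0) : c = 0 := by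
  refine eq_zero_of_τ_star_mul_self ?_
  rw [hc.star_eq]
  exact Complex.ext h (Complex.le_def.1 (τ_sq_nonneg hc)).2.symm

/-- Every self-adjoint element is a multiple of one with `L²`-norm at most `1`. -/
theorem exists_smul_of_isSelfAdjoint {c : W.A} (hc : IsSelfAdjoint c) : ∃ (r : ℝ) (e : W.A),
    IsSelfAdjoint e ∧ (W.τ (e * e)).re ≤ 1 ∧ c * c = r • (e * e) ∧ r = (W.τ (c * c)).re := by
  set t := (W.τ (c * c)).re with ht
  have ht0 : 0 ≤ t := (Complex.le_def.1 (τ_sq_nonneg hc)).1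
  rcases ht0.eq_or_lt with h0 | h0
  · refine ⟨t, 0, IsSelfAdjoint.zero _, by simp, ?_, rfl⟩
    rw [eq_zero_of_τ_sq_re hc h0.symm]; simp
  · have hs : (√t)⁻¹ * (√t)⁻¹ = t⁻¹ := by rw [← mul_inv, Real.mul_self_sqrt ht0]
    have h1 : ((√t)⁻¹ • c) * ((√t)⁻¹ • c) = t⁻¹ • (c * c) := by
      rw [smul_mul_smul_comm, hs]
    refine ⟨t, (√t)⁻¹ • c, by rw [IsSelfAdjoint, star_smul, star_trivial, hc.star_eq], ?_, ?_, rfl⟩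
    · rw [h1, LinearMap.map_smul_of_tower, Complex.smul_re, smul_eq_mul, ← ht,
        inv_mul_cancel₀ h0.ne']
    · rw [h1, smul_smul, mul_inv_cancel₀ h0.ne', one_smul]

/-- The duality of `L¹` and `L^∞`, with test elements in the unit ball of `L¹`. -/
theorem norm_le_of_norm_τ_mul_le' {a : W.A} {C : ℝ} (hC : 0 ≤ C)
    (h : ∀ c : W.A, IsSelfAdjoint c → (W.τ (c * c)).re ≤ 1 → ‖W.τ (c * c * a)‖ ≤ C) :
    ‖a‖ ≤ 2 * C := by
  refine norm_le_of_norm_τ_mul_le hC fun c hc => ?_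
  obtain ⟨r, e, he, he1, hce, hr⟩ := exists_smul_of_isSelfAdjoint hc
  have hr0 : 0 ≤ r := hr ▸ (Complex.le_def.1 (τ_sq_nonneg hc)).1
  rw [← hr, hce, smul_mul_assoc, LinearMap.map_smul_of_tower, norm_smul, Real.norm_of_nonneg hr0,
    mul_comm C]
  exact mul_le_mul_of_nonneg_left (h e he he1) hr0

/-- A functional that is, on positive elements, an `L¹`-limit of functionals `τ(· a)` with `a` in
the algebra is itself of this form, because the approximants converge in operator norm. -/
theorem exists_eq_τ_mul (L : W.A → ℂ)
    (h : ∀ ε > 0, ∃ a : W.A, ∀ c : W.A, IsSelfAdjoint c → (W.τ (c * c)).re ≤ 1 →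
      ‖L c - W.τ (c * c * a)‖ ≤ ε) :
    ∃ a : W.A, ∀ c : W.A, IsSelfAdjoint c → (W.τ (c * c)).re ≤ 1 → L c = W.τ (c * c * a) := by
  choose! a ha using h
  have hpos : ∀ n : ℕ, 0 < (1 : ℝ) / (n + 1) := fun n => Nat.one_div_pos_of_nat
  set u : ℕ → W.A := fun n => a (1 / (n + 1)) with hu
  have hd : ∀ n m : ℕ, dist (u n) (u m) ≤ 2 * (1 / (n + 1) + 1 / (m + 1)) := fun n m => by
    rw [dist_eq_norm]
    refine norm_le_of_norm_τ_mul_le' (add_pos (hpos n) (hpos m)).le fun c hc hc1 => ?_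
    have e : W.τ (c * c * (u n - u m)) =
        (L c - W.τ (c * c * u m)) - (L c - W.τ (c * c * u n)) := by
      rw [mul_sub, map_sub]; ring
    rw [e, add_comm]
    exact (norm_sub_le _ _).trans
      (add_le_add (ha _ (hpos m) c hc hc1) (ha _ (hpos n) c hc hc1))
  have hlim := tendsto_one_div_add_atTop_nhds_zero_nat (𝕜 := ℝ)
  have hcau : CauchySeq u := by
    refine cauchySeq_of_le_tendsto_0 (fun n => 2 * (1 / (n + 1) + 1 / (n + 1)))
      (fun n m N hn hm => (hd n m).trans ?_) ?_
    · have := one_div_le_one_div_of_le (a := (N : ℝ) + 1) (b := n + 1) (by positivity)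
        (by exact_mod_cast Nat.succ_le_succ hn)
      have := one_div_le_one_div_of_le (a := (N : ℝ) + 1) (b := m + 1) (by positivity)
        (by exact_mod_cast Nat.succ_le_succ hm)
      linarith
    · simpa using (hlim.add hlim).const_mul 2
  obtain ⟨b, hb⟩ := cauchySeq_tendsto_of_complete hcau
  refine ⟨b, fun c hc hc1 => ?_⟩
  have h1 : Filter.Tendsto (fun n => W.τ (c * c * u n)) Filter.atTop (𝓝 (W.τ (c * c * b))) :=
    (continuous_τ.tendsto _).comp (hb.const_mul (c * c))
  refine tendsto_nhds_unique ?_ h1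
  refine tendsto_iff_norm_sub_tendsto_zero.2 ?_
  refine squeeze_zero (fun _ => norm_nonneg _) (fun n => ?_) hlim
  rw [norm_sub_rev]
  exact ha _ (hpos n) c hc hc1

end TracialWStar

/-! ### Trace monomials with a variable of degree one -/

namespace TraceMonomial

variable {V : Type}

theorem lift_eq_zero {W : TracialWStar} {s : V → Bool} {X : V → W.A} (hX : ∀ v, s v → X v = 0)
    {w : FreeMonoid V} (hw : w.toList.countP s ≠ 0) : FreeMonoid.lift X w = 0 := by
  obtain ⟨v, hv, hs⟩ := List.countP_pos_iff.1 (Nat.pos_of_ne_zero hw)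
  rw [FreeMonoid.lift_apply]
  exact List.prod_eq_zero (List.mem_map.2 ⟨v, hv, hX v hs⟩)

theorem eval_eq_zero {W : TracialWStar} {s : V → Bool} {X : V → W.A} (hX : ∀ v, s v → X v = 0)
    {m : TraceMonomial V} (hm : m.degree s ≠ 0) : m.eval X = 0 := by
  rw [eval]
  by_cases h : m.word.toList.countP s = 0
  · have h1 : (m.traced.map fun w => w.toList.countP s).sum ≠ 0 := by
      rwa [degree, h, add_zero] at hm
    obtain ⟨n, hn, hn0⟩ : ∃ n ∈ m.traced.map fun w => w.toList.countP s, n ≠ 0 := by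
      by_contra! hcon
      exact h1 (List.sum_eq_zero hcon)
    obtain ⟨w, hw, rfl⟩ := List.mem_map.1 hn
    rw [List.prod_eq_zero, zero_smul]
    exact List.mem_map.2 ⟨w, hw, by rw [lift_eq_zero hX hn0, map_zero]⟩
  · rw [lift_eq_zero hX h, smul_zero]

theorem eval_congr {W : TracialWStar} {s : V → Bool} {X X' : V → W.A}
    (hX : ∀ v, s v = false → X v = X' v) {m : TraceMonomial V} (hm : m.degree s = 0) :
    m.eval X = m.eval X' := by
  have key : ∀ w : FreeMonoid V, w.toList.countP s = 0 →
      FreeMonoid.lift X w = FreeMonoid.lift X' w := by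
    intro w hw
    rw [FreeMonoid.lift_apply, FreeMonoid.lift_apply]
    congr 1
    refine List.map_congr_left fun v hv => hX v ?_
    simpa using List.countP_eq_zero.1 hw v hv
  rw [degree, Nat.add_eq_zero_iff] at hm
  rw [eval, eval, key _ hm.2]
  congr 2
  refine List.map_congr_left fun w hw => ?_
  rw [key w (List.sum_eq_zero_iff.1 hm.1 _ (List.mem_map.2 ⟨w, hw, rfl⟩))]

theorem exists_split {s : V → Bool} {w : FreeMonoid V} (hw : w.toList.countP s = 1) :
    ∃ (v : V) (a b : FreeMonoid V), s v ∧ a.toList.countP s = 0 ∧ b.toList.countP s = 0 ∧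
      w = a * FreeMonoid.of v * b := by
  obtain ⟨v, hv, hs⟩ := List.countP_pos_iff.1 (hw ▸ Nat.one_pos)
  obtain ⟨a, b, hab⟩ := List.append_of_mem hv
  have h1 := hw
  rw [hab, List.countP_append, List.countP_cons, if_pos hs] at h1
  refine ⟨v, FreeMonoid.ofList a, FreeMonoid.ofList b, hs, ?_, ?_, ?_⟩
  · simpa using (by lia : a.countP s = 0)
  · simpa using (by lia : b.countP s = 0)
  · apply FreeMonoid.toList.injective
    simp [hab]

/-- The trace of a trace monomial in which exactly one variable of the family `s` occurs, and that
once, is `τ(v m')` with that variable `v` and a trace monomial `m'` in the other variables: if `v`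
occurs in a traced word, the roles of this word and the untraced one are interchanged. -/
theorem exists_cyclic {s : V → Bool} {m : TraceMonomial V} (hm : m.degree s = 1) :
    ∃ (v : V) (m' : TraceMonomial V), s v ∧ m'.degree s = 0 ∧
      ∀ (W : TracialWStar) (X : V → W.A), W.τ (m.eval X) = W.τ (X v * m'.eval X) := by
  obtain ⟨t, w₀⟩ := m
  simp only [degree] at hm
  by_cases h : w₀.toList.countP s = 0
  · rw [h, add_zero] at hm
    have : ∃ w ∈ t, w.toList.countP s ≠ 0 := by
      by_contra! hcon
      rw [List.sum_eq_zero] at hm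
      · exact zero_ne_one hm
      · intro n hn
        obtain ⟨w, hw, rfl⟩ := List.mem_map.1 hn
        exact hcon w hw
    obtain ⟨w, hwt, hw0⟩ := this
    obtain ⟨t₁, t₂, rfl⟩ := List.append_of_mem hwt
    simp only [List.map_append, List.map_cons, List.sum_append, List.sum_cons] at hm
    obtain ⟨v, a, b, hv, ha, hb, rfl⟩ := exists_split (w := w) (s := s) (by lia)
    refine ⟨v, ⟨w₀ :: (t₁ ++ t₂), b * a⟩, hv, ?_, fun W X => ?_⟩
    · simp only [degree, List.map_cons, List.map_append, List.sum_cons, List.sum_append,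
        FreeMonoid.toList_mul, List.countP_append]
      lia
    · have e : W.τ (FreeMonoid.lift X (a * FreeMonoid.of v * b)) =
          W.τ (X v * FreeMonoid.lift X (b * a)) := by
        simp only [map_mul, FreeMonoid.lift_eval_of]
        rw [mul_assoc, τ_mul_comm, mul_assoc]
      simp only [eval, map_smul, mul_smul_comm, smul_eq_mul, List.map_append, List.map_cons,
        List.prod_append, List.prod_cons]
      rw [e]
      ring
  · obtain ⟨v, a, b, hv, ha, hb, rfl⟩ := exists_split (w := w₀) (s := s) (by lia)
    refine ⟨v, ⟨t, b * a⟩, hv, ?_, fun W X => ?_⟩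
    · simp only [FreeMonoid.toList_mul, List.countP_append] at hm
      simp only [FreeMonoid.toList_of, List.countP_singleton, hv, if_true] at hm
      simp only [degree, FreeMonoid.toList_mul, List.countP_append]
      lia
    · simp only [eval, map_smul, mul_smul_comm, map_mul, FreeMonoid.lift_eval_of]
      rw [mul_assoc, τ_mul_comm, mul_assoc]

theorem continuous_eval {W : TracialWStar} (m : TraceMonomial V) :
    Continuous fun X : V → W.A => m.eval X := by
  have key : ∀ w : FreeMonoid V, Continuous fun X : V → W.A => FreeMonoid.lift X w := fun w => by
    simp only [FreeMonoid.lift_apply]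
    exact continuous_list_prod _ fun v _ => continuous_apply v
  unfold eval
  refine Continuous.smul (continuous_list_prod _ fun w _ => continuous_τ.comp (key w)) (key _)

end TraceMonomial

namespace TracePoly

variable {V : Type} {W : TracialWStar}

theorem continuous_eval (g : TracePoly V) : Continuous fun X : V → W.A => g.eval X :=
  continuous_finsetSum _ fun m _ => (m.continuous_eval).const_smul (g m)

theorem eval_add (g h : TracePoly V) (X : V → W.A) : (g + h).eval X = g.eval X + h.eval X :=
  Finsupp.sum_add_index' (fun _ => zero_smul ℂ _) fun _ a b => add_smul a b _

theorem eval_single (m : TraceMonomial V) (c : ℂ) (X : V → W.A) :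
    TracePoly.eval X (Finsupp.single m c : TracePoly V) = c • m.eval X :=
  Finsupp.sum_single_index (zero_smul ℂ _)

theorem eval_zero (X : V → W.A) : TracePoly.eval X (0 : TracePoly V) = 0 :=
  Finsupp.sum_zero_index

theorem eval_eq_zero {s : V → Bool} {X : V → W.A} (hX : ∀ v, s v → X v = 0)
    {g : TracePoly V} (hg : ∀ m ∈ g.support, m.degree s ≠ 0) : g.eval X = 0 :=
  Finset.sum_eq_zero fun m hm => by
    simp only
    rw [TraceMonomial.eval_eq_zero hX (hg m hm), smul_zero]

/-- The trace polynomials representing the trace of a trace polynomial that is linear in the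
variables `v j`. -/
theorem exists_gradient {ι : Type} [Fintype ι] [DecidableEq ι] {s : V → Bool} {v : ι → V}
    (hv : ∀ u, s u → ∃ j, v j = u)
    (g : TracePoly V) (hg : ∀ m ∈ g.support, m.degree s = 1) :
    ∃ H : ι → TracePoly V,
      (∀ (j : ι) (W : TracialWStar) (X X' : V → W.A), (∀ u, s u = false → X u = X' u) →
        (H j).eval X = (H j).eval X') ∧
      ∀ (W : TracialWStar) (X : V → W.A),
        W.τ (g.eval X) = ∑ j, W.τ (X (v j) * (H j).eval X) := by
  induction g using Finsupp.induction with
  | zero =>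
    exact ⟨0, fun j W X X' _ => by simp [eval_zero], fun W X => by simp [eval_zero]⟩
  | single_add m c g hm hc ih =>
    have hsupp := Finsupp.support_single_add hm hc
    obtain ⟨H, hH1, hH2⟩ := ih fun n hn => hg n (by rw [hsupp]; exact Finset.mem_cons_of_mem hn)
    obtain ⟨u, m', hu, hm', hτ⟩ := TraceMonomial.exists_cyclic (s := s) (m := m)
      (hg m (by rw [hsupp]; exact Finset.mem_cons_self _ _))
    obtain ⟨i, rfl⟩ := hv u hu
    refine ⟨H + Pi.single i (Finsupp.single m' c), fun j W X X' h => ?_, fun W X => ?_⟩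
    · simp only [Pi.add_apply, eval_add, hH1 j W X X' h]
      congr 1
      by_cases hj : j = i
      · subst hj
        simp only [Pi.single_eq_same, eval_single, TraceMonomial.eval_congr h hm']
      · simp only [Pi.single_eq_of_ne hj, eval_zero]
    · simp only [Pi.add_apply, eval_add, eval_single, map_add, map_smul, hτ, hH2, mul_add,
        Finset.sum_add_distrib]
      rw [add_comm]
      congr 1
      rw [Finset.sum_eq_single i]
      · simp [eval_single]
      · intro j _ hj
        simp [Pi.single_eq_of_ne hj, eval_zero]
      · simp

end TracePoly

/-! ### The norms of forms -/

section Forms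

variable {W : TracialWStar} {d d' ℓ : ℕ}

/-- A form vanishes when one of its arguments does, as multilinear forms do. -/
def VanishesAtZero (Λ : (Fin ℓ → W.SA d) → (Fin d' → W.A)) : Prop :=
  ∀ Y i, Y i = 0 → Λ Y = 0

theorem complexify_toTuple {Λ : (Fin ℓ → W.SA d) → (Fin d' → W.A)} (hΛ : VanishesAtZero Λ)
    (Y : Fin ℓ → W.SA d) : complexify Λ (fun i => toTuple (Y i)) = Λ Y := by
  rw [complexify, Finset.sum_eq_single ∅]
  · simp only [Finset.card_empty, pow_zero, one_smul, Finset.notMem_empty, if_false]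
    congr 1
    funext i j
    exact Subtype.ext (by simp [toTuple])
  · intro s _ hs
    obtain ⟨i, hi⟩ := Finset.nonempty_iff_ne_empty.2 hs
    rw [hΛ _ i, smul_zero]
    funext j
    simp only [if_pos hi]
    exact (Y i j).2.imaginaryPart
  · simp

/-- Self-adjoint arguments may be used to bound a form below by its norm. -/
theorem lpNorm_le_of_formNorm_le {Λ : (Fin ℓ → W.SA d) → (Fin d' → W.A)} (hΛ : VanishesAtZero Λ)
    {C : ℝ} (hC : 0 ≤ C) (h : formNorm Λ ≤ ENNReal.ofReal C) {α : ℝ≥0∞} {β : Fin ℓ → ℝ≥0∞}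
    (hα : 1 ≤ α) (hβ : ∀ i, 1 ≤ β i) (hαβ : α⁻¹ = ∑ i, (β i)⁻¹) (Y : Fin ℓ → W.SA d)
    (hY : ∀ i, lpNorm (β i) (toTuple (Y i)) ≤ 1) : lpNorm α (Λ Y) ≤ C := by
  rw [← ENNReal.ofReal_le_ofReal_iff hC, ← complexify_toTuple hΛ]
  refine le_trans ?_ h
  unfold formNorm
  exact le_iSup_of_le α <| le_iSup_of_le β <| le_iSup_of_le hα <| le_iSup_of_le hβ <|
    le_iSup_of_le hαβ <| le_iSup_of_le (fun i => toTuple (Y i)) <| le_iSup_of_le hY le_rfl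

theorem formNorm_le_ctrNorm (f : NCForm d ℓ d') {R : ℝ} {X : W.SA d} (hX : ‖toTuple X‖ ≤ R) :
    formNorm (f W X) ≤ ctrNorm R f := by
  unfold ctrNorm
  exact le_iSup_of_le W <| le_iSup_of_le X <| le_iSup_of_le hX le_rfl

theorem ctrNorm_le_bcNorm (f : NCForm d ℓ d') (R : ℝ) : ctrNorm R f ≤ bcNorm f :=
  le_iSup (fun R => ctrNorm R f) R

theorem formNorm_le_bcNorm (f : NCForm d ℓ d') (X : W.SA d) : formNorm (f W X) ≤ bcNorm f :=
  (formNorm_le_ctrNorm f le_rfl).trans (ctrNorm_le_bcNorm f _)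

/-- The values of the variables at which the trace polynomials of a form are evaluated. -/
def formArg (X : W.SA d) (Y : Fin ℓ → W.SA d) : FormVar d ℓ → W.A :=
  Sum.elim (toTuple X) fun p => toTuple (Y p.1) p.2

/-- The variables of the block `yᵢ`. -/
def inBlock (i : Fin ℓ) : FormVar d ℓ → Bool :=
  Sum.elim (fun _ => false) fun p => decide (p.1 = i)

theorem vanishesAtZero_tracePolyForm {g : Fin d' → TracePoly (FormVar d ℓ)}
    (hg : ∀ j, (g j).IsMultilinear) (X : W.SA d) : VanishesAtZero (tracePolyForm g W X) := by
  intro Y i hY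
  funext j
  refine TracePoly.eval_eq_zero (s := inBlock i) ?_ fun m hm => ?_
  · rintro (v | ⟨i', v⟩) hv
    · simp [inBlock] at hv
    · obtain rfl : i' = i := by simpa [inBlock] using hv
      simp [hY, toTuple]
  · have := hg j m hm i
    unfold inBlock
    lia

theorem IsCtr.vanishesAtZero {f : NCForm d ℓ d'} (hf : IsCtr f) (X : W.SA d) :
    VanishesAtZero (f W X) := by
  intro Y i hY
  obtain ⟨M, hM⟩ := hf.multilinear W X
  rw [hM, M.map_coord_zero i hY]

theorem VanishesAtZero.sub {Λ Λ' : (Fin ℓ → W.SA d) → (Fin d' → W.A)} (h : VanishesAtZero Λ)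
    (h' : VanishesAtZero Λ') : VanishesAtZero (Λ - Λ') := fun Y i hY => by
  rw [Pi.sub_apply, h Y i hY, h' Y i hY, sub_zero]

/-- Uniform approximation of a form by trace polynomials, for all exponents at once. -/
theorem IsCtr.exists_lpNorm_sub_le {f : NCForm d ℓ d'} (hf : IsCtr f) {R ε : ℝ} (hR : 0 < R)
    (hε : 0 < ε) : ∃ g : Fin d' → TracePoly (FormVar d ℓ), (∀ j, (g j).IsMultilinear) ∧
      ∀ (W : TracialWStar) (X : W.SA d), ‖toTuple X‖ ≤ R → ∀ (α : ℝ≥0∞) (β : Fin ℓ → ℝ≥0∞),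
        1 ≤ α → (∀ i, 1 ≤ β i) → α⁻¹ = ∑ i, (β i)⁻¹ → ∀ Y : Fin ℓ → W.SA d,
        (∀ i, lpNorm (β i) (toTuple (Y i)) ≤ 1) →
        lpNorm α (f W X Y - tracePolyForm g W X Y) ≤ ε := by
  obtain ⟨g, hg, hgε⟩ := hf.approx R hR ε hε
  refine ⟨g, hg, fun W X hX α β hα hβ hαβ Y hY => ?_⟩
  exact lpNorm_le_of_formNorm_le (Λ := f W X - tracePolyForm g W X)
    ((hf.vanishesAtZero X).sub (vanishesAtZero_tracePolyForm hg X)) hε.le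
    ((formNorm_le_ctrNorm (f - tracePolyForm g) hX).trans hgε.le) hα hβ hαβ Y hY

theorem norm_τ_le_lpNorm_one (a : Fin 1 → W.A) : ‖W.τ (a 0)‖ ≤ lpNorm 1 a := by
  rw [lpNorm_one]
  simpa using norm_τ_le_τ_abs (a 0)

/-- The self-adjoint tuple with the single nonzero entry `c²`. -/
def singleSq (j : Fin d) (c : selfAdjoint W.A) : W.SA d :=
  Pi.single j ⟨c * c, by
    have : IsSelfAdjoint (c : W.A) := c.2
    rw [selfAdjoint.mem_iff, star_mul, this.star_eq]⟩

theorem toTuple_singleSq (j : Fin d) (c : selfAdjoint W.A) :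
    toTuple (singleSq j c) = Pi.single j ((c : W.A) * c) := by
  funext i
  rcases eq_or_ne i j with rfl | h
  · simp [toTuple, singleSq]
  · simp [toTuple, singleSq, h]

theorem tinner_singleSq (j : Fin d) (c : selfAdjoint W.A) (G : Fin d → W.A) :
    tinner (toTuple (singleSq j c)) G = W.τ (c * c * G j) := by
  have hc : IsSelfAdjoint (c : W.A) := c.2
  rw [toTuple_singleSq, tinner, Finset.sum_eq_single j]
  · rw [Pi.single_eq_same, star_mul, hc.star_eq]
  · intro i _ hi
    simp [Pi.single_eq_of_ne hi]
  · simp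

/-- A real-linear functional of self-adjoint tuples is determined by the tuples `singleSq j c`
with `‖c‖₂ ≤ 1`, since every self-adjoint element is a difference of squares. -/
theorem eq_tinner_of_singleSq (L : W.SA d →ₗ[ℝ] ℂ) (G : Fin d → W.A)
    (h : ∀ j (c : selfAdjoint W.A), (W.τ (c * c)).re ≤ 1 → L (singleSq j c) = W.τ (c * c * G j))
    (Y : W.SA d) : L Y = tinner (toTuple Y) G := by
  let T : W.SA d →ₗ[ℝ] ℂ :=
    { toFun := fun Y => tinner (toTuple Y) G
      map_add' := fun Y Z => by simp [tinner, toTuple, add_mul, Finset.sum_add_distrib]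
      map_smul' := fun r Y => by simp [tinner, toTuple, Finset.mul_sum] }
  have h1 : ∀ j (c : selfAdjoint W.A), L (singleSq j c) = T (singleSq j c) := by
    intro j c
    obtain ⟨r, e, he, he1, hce, -⟩ := exists_smul_of_isSelfAdjoint (W := W) (c := c) c.2
    have h2 : singleSq j c = r • singleSq j ⟨e, he⟩ := by
      rw [singleSq, singleSq, ← Pi.single_smul]
      congr 1
      exact Subtype.ext hce
    rw [h2, map_smul, map_smul, h j ⟨e, he⟩ he1]
    congr 1
    exact (tinner_singleSq j ⟨e, he⟩ G).symm
  have h3 : ∀ j (y : selfAdjoint W.A), L (Pi.single j y) = T (Pi.single j y) := by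
    intro j y
    have h4 : (Pi.single j y : W.SA d) =
        (1 / 4 : ℝ) • (singleSq j (y + 1) - singleSq j (y - 1)) := by
      rw [singleSq, singleSq, ← Pi.single_sub, ← Pi.single_smul]
      congr 1
      refine Subtype.ext ?_
      simp only [selfAdjoint.val_smul, AddSubgroup.coe_sub, AddSubgroup.coe_add,
        selfAdjoint.val_one, add_mul, mul_add, sub_mul, mul_sub, mul_one, one_mul]
      module
    rw [h4, map_smul, map_smul, map_sub, map_sub, h1, h1]
  have h5 : L Y = T Y := by
    have : Y = ∑ j, (Pi.single j (Y j) : W.SA d) := (Finset.univ_sum_single Y).symm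
    rw [this, map_sum, map_sum]
    exact Finset.sum_congr rfl fun j _ => h3 j _
  exact h5

/-- The trace of a form in `C_tr(𝓜^{ℓ+1})` is `⟨Y, G(X)[Z]⟩_τ`, where `Y` is its first argument
and `G` is a locally uniform operator norm limit of trace polynomials. The approximating trace
polynomials are evaluated with the block of `Y` set to zero; they do not depend on it. -/
theorem IsCtr.exists_tinner {F : NCForm d (ℓ + 1) 1} (hF : IsCtr F) :
    ∃ G : ∀ W : TracialWStar, W.SA d → (Fin ℓ → W.SA d) → Fin d → W.A,
      (∀ R : ℝ, 0 < R → ∀ ε : ℝ, 0 < ε → ∃ H : Fin d → TracePoly (FormVar d (ℓ + 1)),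
        ∀ (W : TracialWStar) (X : W.SA d) (Z : Fin ℓ → W.SA d), ‖toTuple X‖ ≤ R →
          (∀ i, ‖toTuple (Z i)‖ ≤ 1) →
          ∀ j, ‖G W X Z j - (H j).eval (formArg X (Fin.cons 0 Z))‖ ≤ ε) ∧
      ∀ (W : TracialWStar) (X : W.SA d) (Z : Fin ℓ → W.SA d), (∀ i, ‖toTuple (Z i)‖ ≤ 1) →
        ∀ Y : W.SA d, W.τ (F W X (Fin.cons Y Z) 0) = tinner (toTuple Y) (G W X Z) := by
  have key : ∀ R : ℝ, 0 < R → ∀ ε : ℝ, 0 < ε → ∃ H : Fin d → TracePoly (FormVar d (ℓ + 1)),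
      ∀ (W : TracialWStar) (X : W.SA d) (Z : Fin ℓ → W.SA d), ‖toTuple X‖ ≤ R →
        (∀ i, ‖toTuple (Z i)‖ ≤ 1) → ∀ (j : Fin d) (c : selfAdjoint W.A), (W.τ (c * c)).re ≤ 1 →
        ‖W.τ (F W X (Fin.cons (singleSq j c) Z) 0) -
          W.τ (c * c * (H j).eval (formArg X (Fin.cons 0 Z)))‖ ≤ ε := by
    intro R hR ε hε
    obtain ⟨g, hg, hgε⟩ := hF.exists_lpNorm_sub_le hR hε
    obtain ⟨H, hH1, hH2⟩ := (g 0).exists_gradient (s := inBlock 0)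
      (v := fun j : Fin d => (Sum.inr (0, j) : FormVar d (ℓ + 1))) (by
        rintro (u | ⟨i, u⟩) hu
        · simp [inBlock] at hu
        · exact ⟨u, by simpa [inBlock, eq_comm] using hu⟩) fun m hm => hg 0 m hm 0
    refine ⟨H, fun W X Z hX hZ j c hc => ?_⟩
    have h1 := hgε W X hX 1 (Fin.cons 1 fun _ => ∞) le_rfl
      (Fin.cases le_rfl fun _ => by simp) (by simp [Fin.sum_univ_succ])
      (Fin.cons (singleSq j c) Z) (by
        refine Fin.cases ?_ fun i => ?_
        · simpa [toTuple_singleSq, lpNorm_one_single j (c := (c : W.A)) c.2] using hc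
        · simpa [lpNorm_top] using hZ i)
    refine le_trans ?_ ((norm_τ_le_lpNorm_one _).trans h1)
    have h2 : W.τ (tracePolyForm g W X (Fin.cons (singleSq j c) Z) 0) =
        W.τ (c * c * (H j).eval (formArg X (Fin.cons 0 Z))) := by
      have h3 : ∀ i, (H i).eval (formArg X (Fin.cons (singleSq j c) Z)) =
          (H i).eval (formArg X (Fin.cons 0 Z)) := fun i => by
        refine hH1 i W _ _ ?_
        rintro (u | ⟨k, u⟩) hu
        · rfl
        · have hk : k ≠ 0 := by simpa [inBlock] using hu
          obtain ⟨k, rfl⟩ := Fin.exists_succ_eq.2 hk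
          rfl
      refine (hH2 W (formArg X (Fin.cons (singleSq j c) Z))).trans ?_
      simp only [h3]
      have h4 := tinner_singleSq j c fun i => (H i).eval (formArg X (Fin.cons 0 Z))
      rw [← h4, tinner]
      refine Finset.sum_congr rfl fun i _ => ?_
      congr 2
      exact (singleSq j c i).2.star_eq.symm
    rw [Pi.sub_apply, map_sub, h2]
  have hG : ∀ (W : TracialWStar) (X : W.SA d) (Z : Fin ℓ → W.SA d), ∃ G : Fin d → W.A,
      (∀ i, ‖toTuple (Z i)‖ ≤ 1) → ∀ (j : Fin d) (c : selfAdjoint W.A), (W.τ (c * c)).re ≤ 1 →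
        W.τ (F W X (Fin.cons (singleSq j c) Z) 0) = W.τ (c * c * G j) := by
    intro W X Z
    by_cases hZ : ∀ i, ‖toTuple (Z i)‖ ≤ 1
    swap
    · exact ⟨0, fun h => absurd h hZ⟩
    have : ∀ j : Fin d, ∃ a : W.A, ∀ c : W.A, ∀ hc : IsSelfAdjoint c, (W.τ (c * c)).re ≤ 1 →
        W.τ (F W X (Fin.cons (singleSq j ⟨c, hc⟩) Z) 0) = W.τ (c * c * a) := by
      intro j
      classical
      obtain ⟨a, ha⟩ := exists_eq_τ_mul (W := W)
        (fun c => if hc : IsSelfAdjoint c then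
          W.τ (F W X (Fin.cons (singleSq j ⟨c, hc⟩) Z) 0) else 0) fun ε hε => by
        obtain ⟨H, hH⟩ := key (‖toTuple X‖ + 1) (by positivity) ε hε
        refine ⟨(H j).eval (formArg X (Fin.cons 0 Z)), fun c hc hc1 => ?_⟩
        simp only [dif_pos hc]
        exact hH W X Z (by linarith) hZ j ⟨c, hc⟩ hc1
      refine ⟨a, fun c hc hc1 => ?_⟩
      have := ha c hc hc1
      rwa [dif_pos hc] at this
    choose G hG using this
    exact ⟨G, fun _ j c hc => hG j c c.2 hc⟩
  choose G hG using hG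
  refine ⟨G, fun R hR ε hε => ?_, fun W X Z hZ Y => ?_⟩
  · obtain ⟨H, hH⟩ := key R hR (ε / 2) (by positivity)
    refine ⟨H, fun W X Z hX hZ j => ?_⟩
    have h := norm_le_of_norm_τ_mul_le'
      (a := G W X Z j - (H j).eval (formArg X (Fin.cons 0 Z))) (C := ε / 2) (by positivity)
      fun c hc hc1 => by
        have := hH W X Z hX hZ j ⟨c, hc⟩ hc1
        rw [hG W X Z hZ j ⟨c, hc⟩ hc1] at this
        rwa [mul_sub, map_sub]
    linarith
  · obtain ⟨M, hM⟩ := hF.multilinear W X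
    let L : W.SA d →ₗ[ℝ] ℂ :=
      (W.τ.restrictScalars ℝ) ∘ₗ (LinearMap.proj 0) ∘ₗ (M.toLinearMap (Fin.cons 0 Z) 0)
    have hL : ∀ Y, L Y = W.τ (F W X (Fin.cons Y Z) 0) := fun Y => by
      simp [L, hM]
    rw [← hL]
    refine eq_tinner_of_singleSq L _ (fun j c hc => ?_) Y
    rw [hL]
    exact hG W X Z hZ j c hc

end Forms

/-! ### Gradients -/

section Gradient

variable {W : TracialWStar} {d : ℕ}

theorem τ_algebraMap (z : ℂ) : W.τ (algebraMap ℂ W.A z) = z := by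
  rw [Algebra.algebraMap_eq_smul_one, map_smul, τ_one, smul_eq_mul, mul_one]

theorem toTuple_injective : Function.Injective (toTuple : W.SA d → Fin d → W.A) :=
  fun _ _ h => funext fun j => Subtype.ext (congrFun h j)

theorem toTuple_add (X Y : W.SA d) : toTuple (X + Y) = toTuple X + toTuple Y := rfl

theorem toTuple_sub (X Y : W.SA d) : toTuple (X - Y) = toTuple X - toTuple Y := rfl

theorem toTuple_smul (r : ℝ) (X : W.SA d) : toTuple (r • X) = r • toTuple X := rfl

theorem norm_toTuple (X : W.SA d) : ‖toTuple X‖ = ‖X‖ := by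
  simp only [Pi.norm_def]
  rfl

theorem continuous_toTuple : Continuous (toTuple : W.SA d → Fin d → W.A) :=
  continuous_pi fun j => continuous_subtype_val.comp (continuous_apply j)

theorem IsGradientAt.unique {φ : NCFun d} {X G G' : W.SA d} (h : IsGradientAt φ W X G)
    (h' : IsGradientAt φ W X G') : G = G' := by
  have h1 := congrArg W.τ ((h (G - G')).unique (h' (G - G')))
  rw [τ_algebraMap, τ_algebraMap] at h1
  refine toTuple_injective (sub_eq_zero.1 (eq_zero_of_tinner_self ?_))
  rw [tinner_sub_right, ← toTuple_sub, h1, sub_self, Complex.zero_re]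

theorem IsGradientAt.ncGradient_eq {φ : NCFun d} {X G : W.SA d} (h : IsGradientAt φ W X G) :
    ncGradient φ W X = G := by
  have h' : ∃ G, IsGradientAt φ W X G := ⟨G, h⟩
  rw [ncGradient, dif_pos h']
  exact h'.choose_spec.unique h

/-- Shifting the base point of a directional derivative. -/
theorem hasDerivAt_line {E : Type*} [NormedAddCommGroup E] [NormedSpace ℝ E] {f : W.SA d → E}
    {X Z : W.SA d} {t : ℝ} {f' : E}
    (h : HasDerivAt (fun s : ℝ => f (X + t • Z + s • Z)) f' 0) :
    HasDerivAt (fun s : ℝ => f (X + s • Z)) f' t := by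
  have h1 : HasDerivAt (fun s : ℝ => f (X + t • Z + (s - t) • Z)) f' t := by
    rw [← sub_self t] at h
    simpa using h.comp_sub_const t t
  refine h1.congr_of_eventuallyEq (Filter.Eventually.of_forall fun s => ?_)
  simp only
  congr 1
  module

/-- A tuple pairing to real numbers with all self-adjoint tuples is self-adjoint. -/
theorem isSelfAdjoint_of_tinner_im {G : Fin d → W.A}
    (h : ∀ Y : W.SA d, (tinner (toTuple Y) G).im = 0) (j : Fin d) : IsSelfAdjoint (G j) := by
  have hsa : ∀ i, IsSelfAdjoint (Complex.I • (G i - star (G i))) := fun i => by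
    rw [IsSelfAdjoint, star_smul, star_sub, star_star]
    simp only [Complex.star_def, Complex.conj_I]
    module
  have key : ∀ Y : W.SA d, tinner (toTuple Y) (fun i => Complex.I • (G i - star (G i))) = 0 := by
    intro Y
    have h1 : tinner (toTuple Y) (fun i => Complex.I • (G i - star (G i))) =
        Complex.I * (tinner (toTuple Y) G - starRingEnd ℂ (tinner (toTuple Y) G)) := by
      simp only [tinner, map_sum, ← τ_star, mul_sub, Finset.mul_sum, ← Finset.sum_sub_distrib]
      refine Finset.sum_congr rfl fun i _ => ?_
      have : star (toTuple Y i) = toTuple Y i := (Y i).2.star_eq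
      rw [mul_smul_comm, map_smul, smul_eq_mul, mul_sub, map_sub, mul_sub, star_mul, star_star,
        this, τ_mul_comm (star (G i))]
    rw [h1, Complex.conj_eq_iff_im.2 (h Y), sub_self, mul_zero]
  have h2 := key fun i => ⟨_, hsa i⟩
  have h3 := congrFun (eq_zero_of_tinner_self (Y := fun i => Complex.I • (G i - star (G i)))
    (congrArg Complex.re h2)) j
  have h4 : G j - star (G j) = 0 := (smul_eq_zero.1 h3).resolve_left Complex.I_ne_zero
  exact (sub_eq_zero.1 h4).symm

theorem τ_im_eq_zero_of_trFun {f : NCFun d} {X : W.SA d} (h : IsSelfAdjoint (trFun f W X)) :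
    (W.τ (f W X)).im = 0 := by
  have := congrArg W.τ h.star_eq
  rw [τ_star, trFun, τ_algebraMap] at this
  exact Complex.conj_eq_iff_im.1 this

theorem eq_zero_of_hasDerivAt_im {u : ℝ → ℂ} {u' : ℂ} {t : ℝ} (hu : HasDerivAt u u' t)
    (h : ∀ s, (u s).im = 0) : u'.im = 0 := by
  have h1 : HasDerivAt (fun s => (u s).im) u'.im t :=
    (Complex.imCLM.hasFDerivAt.comp_hasDerivAt t hu)
  simp only [h] at h1
  exact h1.unique (hasDerivAt_const t 0)

theorem hasDerivAt_τ {u : ℝ → W.A} {u' : W.A} {t : ℝ} (h : HasDerivAt u u' t) :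
    HasDerivAt (fun s => W.τ (u s)) (W.τ u') t :=
  ((τCLM W).restrictScalars ℝ).hasFDerivAt.comp_hasDerivAt t h

/-- A weakly differentiable curve in `A` with norm continuous weak derivative is differentiable in
norm; here "weak" refers to the functionals `τ(c² ·)`. -/
theorem hasDerivAt_of_hasDerivAt_τ {q D : ℝ → W.A} (hD : ContinuousAt D 0)
    (h : ∀ c : W.A, IsSelfAdjoint c → ∀ t : ℝ,
      HasDerivAt (fun s => W.τ (c * c * q s)) (W.τ (c * c * D t)) t) :
    HasDerivAt q (D 0) 0 := by
  rw [hasDerivAt_iff_isLittleO, Asymptotics.isLittleO_iff]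
  intro ε hε
  obtain ⟨δ, hδ, hDδ⟩ := Metric.continuousAt_iff.1 hD (ε / 2) (by positivity)
  filter_upwards [Metric.ball_mem_nhds 0 hδ] with t ht
  have h1 : ‖q t - q 0 - t • D 0‖ ≤ 2 * (ε / 2 * ‖t‖) := by
    refine norm_le_of_norm_τ_mul_le (by positivity) fun c hc => ?_
    have hv : ∀ s : ℝ, HasDerivAt (fun s : ℝ => W.τ (c * c * q s) - s • W.τ (c * c * D 0))
        (W.τ (c * c * D s) - W.τ (c * c * D 0)) s := fun s => by
      simpa using (h c hc s).fun_sub ((hasDerivAt_id s).smul_const (W.τ (c * c * D 0)))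
    have hb : ∀ s ∈ Metric.ball (0 : ℝ) δ,
        ‖W.τ (c * c * D s) - W.τ (c * c * D 0)‖ ≤ ε / 2 * (W.τ (c * c)).re := fun s hs => by
      rw [← map_sub, ← mul_sub]
      refine (norm_τ_sq_mul_le hc _).trans ?_
      have := (hDδ hs).le
      rw [dist_eq_norm] at this
      exact mul_le_mul_of_nonneg_right this (Complex.le_def.1 (τ_sq_nonneg hc)).1
    have h2 := (convex_ball (0 : ℝ) δ).norm_image_sub_le_of_norm_hasDerivWithin_le
      (fun s _ => (hv s).hasDerivWithinAt) hb (Metric.mem_ball_self hδ) ht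
    have e : W.τ (c * c * (q t - q 0 - t • D 0)) =
        W.τ (c * c * q t) - t • W.τ (c * c * D 0) -
          (W.τ (c * c * q 0) - (0 : ℝ) • W.τ (c * c * D 0)) := by
      rw [mul_sub, mul_sub, map_sub, map_sub, mul_smul_comm, LinearMap.map_smul_of_tower]
      simp only [zero_smul]
      ring
    rw [e]
    refine h2.trans (le_of_eq ?_)
    rw [sub_zero]
    ring
  simp only [sub_zero]
  linarith

theorem continuousAt_of_approx {E : Type*} [SeminormedAddCommGroup E] {D : ℝ → E}
    (h : ∀ ε > 0, ∃ u : ℝ → E, Continuous u ∧ ∀ t : ℝ, |t| ≤ 1 → ‖D t - u t‖ ≤ ε) :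
    ContinuousAt D 0 := by
  rw [Metric.continuousAt_iff]
  intro ε hε
  obtain ⟨u, hu, hDu⟩ := h (ε / 3) (by positivity)
  obtain ⟨δ, hδ, hδu⟩ := Metric.continuous_iff.1 hu 0 (ε / 4) (by positivity)
  refine ⟨min δ 1, by positivity, fun t ht => ?_⟩
  have ht' : |t| < min δ 1 := by simpa using ht
  have h1 := hDu t (ht'.le.trans (min_le_right _ _))
  have h0 := hDu 0 (by simp)
  have h2 := hδu t (lt_of_lt_of_le (by simpa using ht') (min_le_left δ 1))
  rw [dist_eq_norm] at h2 ⊢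
  have e : D t - D 0 = (D t - u t) + (u t - u 0) - (D 0 - u 0) := by abel
  rw [e]
  have := (norm_sub_le ((D t - u t) + (u t - u 0)) (D 0 - u 0)).trans
    (add_le_add_left (norm_add_le _ _) _)
  linarith

end Gradient

section GradientOfTrace

variable {d : ℕ} {f : NCFun d} {F : ∀ n : ℕ, NCForm d n 1}

theorem hasDerivAt_trFun (h0 : ∀ W X Y, F 0 W X Y = fun _ => f W X)
    (h1 : ∀ (W : TracialWStar) (X : W.SA d) (Y : Fin 0 → W.SA d) (Z : W.SA d),
      HasDerivAt (fun t : ℝ => F 0 W (X + t • Z) Y) (F 1 W X (Fin.snoc Y Z)) 0)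
    (W : TracialWStar) (X Y : W.SA d) :
    HasDerivAt (fun t : ℝ => W.τ (f W (X + t • Y))) (W.τ (F 1 W X (Fin.cons Y Fin.elim0) 0)) 0 := by
  have h := hasDerivAt_pi.1 (h1 W X Fin.elim0 Y) 0
  simp only [h0] at h
  have e : (Fin.snoc (α := fun _ => W.SA d) Fin.elim0 Y : Fin 1 → W.SA d) =
      Fin.cons Y Fin.elim0 := by
    funext i
    fin_cases i
    rfl
  rw [e] at h
  exact hasDerivAt_τ h

/-- The gradient of `tr(f)` exists and is a locally uniform limit of trace polynomials. -/
theorem isGradientAt_ncGradient_trFun (h0 : ∀ W X Y, F 0 W X Y = fun _ => f W X)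
    (hF : IsCtr (F 1))
    (h1 : ∀ (W : TracialWStar) (X : W.SA d) (Y : Fin 0 → W.SA d) (Z : W.SA d),
      HasDerivAt (fun t : ℝ => F 0 W (X + t • Z) Y) (F 1 W X (Fin.snoc Y Z)) 0)
    (hsa : ∀ W X, IsSelfAdjoint (trFun f W X)) :
    (∀ (W : TracialWStar) (X : W.SA d),
      IsGradientAt (trFun f) W X (ncGradient (trFun f) W X)) ∧
    (∀ (W : TracialWStar) (X Y : W.SA d), W.τ (F 1 W X (Fin.cons Y Fin.elim0) 0) =
      tinner (toTuple Y) (toTuple (ncGradient (trFun f) W X))) ∧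
    ∀ R : ℝ, 0 < R → ∀ ε : ℝ, 0 < ε → ∃ H : Fin d → TracePoly (FormVar d 1),
      ∀ (W : TracialWStar) (X : W.SA d), ‖toTuple X‖ ≤ R → ∀ j,
        ‖toTuple (ncGradient (trFun f) W X) j - (H j).eval (formArg X 0)‖ ≤ ε := by
  obtain ⟨G, hG1, hG2⟩ := hF.exists_tinner
  have hder := hasDerivAt_trFun h0 h1
  have hGsa : ∀ (W : TracialWStar) (X : W.SA d) (j : Fin d),
      IsSelfAdjoint (G W X Fin.elim0 j) := fun W X => by
    refine isSelfAdjoint_of_tinner_im fun Y => ?_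
    rw [← hG2 W X Fin.elim0 (fun i => i.elim0) Y]
    exact eq_zero_of_hasDerivAt_im (hder W X Y) fun s => τ_im_eq_zero_of_trFun (hsa W _)
  have hgrad : ∀ (W : TracialWStar) (X : W.SA d),
      IsGradientAt (trFun f) W X (fun j => ⟨_, hGsa W X j⟩) := fun W X Y => by
    have h := ((algebraMapCLM ℂ W.A).restrictScalars ℝ)
      |>.hasFDerivAt.comp_hasDerivAt (0 : ℝ) (hder W X Y)
    rw [hG2 W X Fin.elim0 (fun i => i.elim0) Y] at h
    exact h
  have heq : ∀ (W : TracialWStar) (X : W.SA d),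
      toTuple (ncGradient (trFun f) W X) = G W X Fin.elim0 := fun W X => by
    rw [(hgrad W X).ncGradient_eq]; rfl
  refine ⟨fun W X => ?_, fun W X Y => ?_, fun R hR ε hε => ?_⟩
  · rw [(hgrad W X).ncGradient_eq]
    exact hgrad W X
  · rw [heq]
    exact hG2 W X Fin.elim0 (fun i => i.elim0) Y
  · obtain ⟨H, hH⟩ := hG1 R hR ε hε
    refine ⟨H, fun W X hX j => ?_⟩
    have h2 := hH W X Fin.elim0 hX (fun i => i.elim0) j
    have e : (Fin.cons (α := fun _ => W.SA d) 0 Fin.elim0 : Fin 1 → W.SA d) = 0 := by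
      funext i
      fin_cases i
      rfl
    rw [e] at h2
    rw [heq]
    exact h2

/-- The gradient of `tr(f)` has directional derivatives in operator norm. The weak derivatives
come from the second derivative of `f`; these are norm continuous, as locally uniform limits of
trace polynomials. -/
theorem differentiableAt_ncGradient_trFun (hF : IsCtr (F 2))
    (h2 : ∀ (W : TracialWStar) (X : W.SA d) (Y : Fin 1 → W.SA d) (Z : W.SA d),
      HasDerivAt (fun t : ℝ => F 1 W (X + t • Z) Y) (F 2 W X (Fin.snoc Y Z)) 0)
    (hτ : ∀ (W : TracialWStar) (X Y : W.SA d), W.τ (F 1 W X (Fin.cons Y Fin.elim0) 0) =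
      tinner (toTuple Y) (toTuple (ncGradient (trFun f) W X)))
    (W : TracialWStar) (X Z : W.SA d) :
    DifferentiableAt ℝ (fun t : ℝ => toTuple (ncGradient (trFun f) W (X + t • Z))) 0 := by
  obtain ⟨G, hG1, hG2⟩ := hF.exists_tinner
  have hunit : ∀ Z : W.SA d, ‖toTuple Z‖ ≤ 1 →
      DifferentiableAt ℝ (fun t : ℝ => toTuple (ncGradient (trFun f) W (X + t • Z))) 0 := by
    intro Z hZ
    refine differentiableAt_pi.2 fun j => HasDerivAt.differentiableAt
      (hasDerivAt_of_hasDerivAt_τ (D := fun t => G W (X + t • Z) (fun _ => Z) j) ?_ ?_)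
    · refine continuousAt_of_approx fun ε hε => ?_
      obtain ⟨H, hH⟩ := hG1 (‖toTuple X‖ + 1) (by positivity) ε hε
      refine ⟨fun t => (H j).eval (formArg (X + t • Z) (Fin.cons 0 fun _ => Z)), ?_, ?_⟩
      · refine (H j).continuous_eval.comp (continuous_pi ?_)
        rintro (v | p)
        · have : Continuous fun t : ℝ => toTuple (X + t • Z) :=
            continuous_toTuple.comp (by fun_prop)
          exact (continuous_apply v).comp this
        · exact continuous_const
      · intro t ht
        refine hH W _ _ ?_ (fun _ => hZ) j
        rw [toTuple_add, toTuple_smul]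
        refine (norm_add_le _ _).trans ?_
        rw [norm_smul, Real.norm_eq_abs]
        have := mul_le_mul ht hZ (norm_nonneg _) zero_le_one
        linarith
    · intro c hc t
      have h3 := hasDerivAt_pi.1 (h2 W (X + t • Z)
        (Fin.cons (singleSq j ⟨c, hc⟩) Fin.elim0) Z) 0
      have e : (Fin.snoc (α := fun _ => W.SA d) (Fin.cons (singleSq j ⟨c, hc⟩) Fin.elim0 :
          Fin 1 → W.SA d) Z : Fin 2 → W.SA d) = Fin.cons (singleSq j ⟨c, hc⟩) fun _ => Z := by
        funext i
        fin_cases i <;> rfl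
      rw [e] at h3
      have h4 := hasDerivAt_line (f := fun X => W.τ (F 1 W X _ 0)) (hasDerivAt_τ h3)
      rw [hG2 W _ (fun _ => Z) (fun _ => hZ), tinner_singleSq] at h4
      refine h4.congr_of_eventuallyEq (Filter.Eventually.of_forall fun s => ?_)
      simp only
      rw [hτ, tinner_singleSq]
  set r := ‖toTuple Z‖ with hr
  rcases eq_or_ne r 0 with h | h
  · exact hunit Z (by rw [← hr, h]; exact zero_le_one)
  · have h5 := hunit (r⁻¹ • Z) (by
      rw [toTuple_smul, norm_smul, norm_inv, norm_norm, ← hr, inv_mul_cancel₀ h])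
    have h6 : DifferentiableAt ℝ (fun t : ℝ => t * r) 0 := by fun_prop
    rw [← zero_mul r] at h5
    have h7 := DifferentiableAt.comp (0 : ℝ) h5 h6
    refine h7.congr_of_eventuallyEq (Filter.Eventually.of_forall fun t => ?_)
    simp only [Function.comp_apply]
    rw [smul_smul, mul_assoc, mul_inv_cancel₀ h, mul_one]

end GradientOfTrace

/-! ### Maps whose derivative is close to a multiple of the identity -/

section Contraction

variable {W : TracialWStar} {d : ℕ}

instance : CompleteSpace (selfAdjoint W.A) := by
  have : IsClosed {a : W.A | star a = a} := isClosed_eq continuous_star continuous_id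
  exact this.completeSpace_coe

instance : CompleteSpace (W.SA d) := Pi.complete _

/-- `g` has directional derivatives `∂g(X)[Y]` in operator norm. -/
def HasDirectionalDerivs (g : NCVec d d) : Prop :=
  ∀ (W : TracialWStar) (X Y : W.SA d),
    DifferentiableAt ℝ (fun t : ℝ => toTuple (g W (X + t • Y))) 0

/-- The directional derivative `∂g(X)[Y]`. -/
def dirDeriv (g : NCVec d d) (X Y : W.SA d) : Fin d → W.A :=
  derivForm g W X fun _ => Y

theorem HasDirectionalDerivs.hasDerivAt {g : NCVec d d} (hg : HasDirectionalDerivs g)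
    (X Y : W.SA d) (t : ℝ) :
    HasDerivAt (fun s : ℝ => toTuple (g W (X + s • Y))) (dirDeriv g (X + t • Y) Y) t :=
  hasDerivAt_line (f := fun X => toTuple (g W X)) (hg W (X + t • Y) Y).hasDerivAt

theorem HasDirectionalDerivs.dirDeriv_smul {g : NCVec d d} (hg : HasDirectionalDerivs g)
    (X Y : W.SA d) (r : ℝ) : dirDeriv g X (r • Y) = r • dirDeriv g X Y := by
  have h1 := hg.hasDerivAt X Y (0 * r)
  have h2 := h1.scomp (0 : ℝ) ((hasDerivAt_id (0 : ℝ)).mul_const r)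
  have h3 := hg.hasDerivAt X (r • Y) 0
  rw [zero_smul, add_zero] at h3
  rw [zero_mul, zero_smul, add_zero, one_mul] at h2
  refine h3.unique (h2.congr_of_eventuallyEq (Filter.Eventually.of_forall fun t => ?_))
  simp only [Function.comp_apply, id, smul_smul]

theorem dirDeriv_zero (g : NCVec d d) (X : W.SA d) : dirDeriv g X 0 = 0 := by
  simp [dirDeriv, derivForm]

theorem vanishesAtZero_derivForm_sub (g : NCVec d d) (K : ℝ) (X : W.SA d) :
    VanishesAtZero ((derivForm g - K • idForm d) W X) := by
  intro Y i hY
  have : Y = fun _ => 0 := funext fun j => by rw [← hY, Subsingleton.elim j i]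
  subst this
  have h1 : derivForm g W X (fun _ => 0) = 0 := dirDeriv_zero g X
  have h2 : idForm d W X (fun _ => 0) = 0 := rfl
  change derivForm g W X (fun _ => 0) - K • idForm d W X (fun _ => 0) = 0
  rw [h1, h2, smul_zero, sub_zero]

variable {g : NCVec d d} {K c : ℝ}

theorem lpNorm_dirDeriv_sub_le_of_le_one (hc : 0 ≤ c)
    (hbound : bcNorm (derivForm g - K • idForm d) ≤ ENNReal.ofReal c) {α : ℝ≥0∞} (hα : 1 ≤ α)
    (X Y : W.SA d) (hY : lpNorm α (toTuple Y) ≤ 1) :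
    lpNorm α (dirDeriv g X Y - K • toTuple Y) ≤ c :=
  lpNorm_le_of_formNorm_le (vanishesAtZero_derivForm_sub g K X) hc
    ((formNorm_le_bcNorm _ X).trans hbound) (β := fun _ => α) hα (fun _ => hα) (by simp)
    (fun _ => Y) fun _ => hY

theorem lpNorm_dirDeriv_sub_le (hg : HasDirectionalDerivs g) (hc : 0 ≤ c)
    (hbound : bcNorm (derivForm g - K • idForm d) ≤ ENNReal.ofReal c) {α : ℝ≥0∞} (hα : 1 ≤ α)
    (hnn : ∀ Y : Fin d → W.A, 0 ≤ lpNorm α Y) (h0 : ∀ Y : Fin d → W.A, lpNorm α Y = 0 → Y = 0)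
    (hsmul : ∀ (r : ℝ) (Y : Fin d → W.A), 0 ≤ r → lpNorm α (r • Y) = r * lpNorm α Y)
    (X Y : W.SA d) :
    lpNorm α (dirDeriv g X Y - K • toTuple Y) ≤ c * lpNorm α (toTuple Y) := by
  rcases (hnn (toTuple Y)).eq_or_lt with h | h
  · obtain rfl : Y = 0 := toTuple_injective (h0 _ h.symm)
    have e : dirDeriv g X 0 - K • toTuple (0 : W.SA d) = (0 : ℝ) • (0 : Fin d → W.A) := by
      rw [dirDeriv_zero, zero_smul, zero_sub, neg_eq_zero]
      exact smul_zero K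
    rw [e, hsmul _ _ le_rfl, zero_mul]
    exact mul_nonneg hc (hnn _)
  · set r := lpNorm α (toTuple Y) with hr
    have h1 := lpNorm_dirDeriv_sub_le_of_le_one hc hbound hα X (r⁻¹ • Y) (by
      rw [toTuple_smul, hsmul _ _ (inv_nonneg.2 h.le), ← hr, inv_mul_cancel₀ h.ne'])
    rw [hg.dirDeriv_smul, toTuple_smul, smul_comm K, ← smul_sub, hsmul _ _ (inv_nonneg.2 h.le),
      inv_mul_le_iff₀ h] at h1
    linarith

theorem norm_dirDeriv_sub_le (hg : HasDirectionalDerivs g) (hc : 0 ≤ c)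
    (hbound : bcNorm (derivForm g - K • idForm d) ≤ ENNReal.ofReal c) (X Y : W.SA d) :
    ‖dirDeriv g X Y - K • toTuple Y‖ ≤ c * ‖toTuple Y‖ := by
  have := lpNorm_dirDeriv_sub_le hg hc hbound (α := ∞) le_top
    (fun Y => by rw [lpNorm_top]; exact norm_nonneg _)
    (fun Y h => by rwa [lpNorm_top, norm_eq_zero] at h)
    (fun r Y hr => by rw [lpNorm_top, lpNorm_top, norm_smul, Real.norm_of_nonneg hr]) X Y
  rwa [lpNorm_top, lpNorm_top] at this

theorem tinner_smul_self_re (r : ℝ) (Y : Fin d → W.A) :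
    (tinner (r • Y) (r • Y)).re = r ^ 2 * (tinner Y Y).re := by
  rw [tinner_smul_left, tinner_smul_right, Complex.re_ofReal_mul, Complex.re_ofReal_mul]
  ring

theorem sqrt_tinner_dirDeriv_sub_le (hg : HasDirectionalDerivs g) (hc : 0 ≤ c)
    (hbound : bcNorm (derivForm g - K • idForm d) ≤ ENNReal.ofReal c) (X Y : W.SA d) :
    √(tinner (dirDeriv g X Y - K • toTuple Y) (dirDeriv g X Y - K • toTuple Y)).re ≤
      c * √(tinner (toTuple Y) (toTuple Y)).re := by
  have := lpNorm_dirDeriv_sub_le hg hc hbound (α := 2) (by norm_num)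
    (fun Y => by rw [lpNorm_two]; exact Real.sqrt_nonneg _)
    (fun Y h => by
      rw [lpNorm_two, Real.sqrt_eq_zero (tinner_self_nonneg Y)] at h
      exact eq_zero_of_tinner_self h)
    (fun r Y hr => by
      rw [lpNorm_two, lpNorm_two, tinner_smul_self_re, Real.sqrt_mul (sq_nonneg r),
        Real.sqrt_sq hr]) X Y
  rwa [lpNorm_two, lpNorm_two] at this

/-- `∂g` is positive semidefinite with respect to `⟨·,·⟩_τ`. -/
theorem tinner_dirDeriv_nonneg (hg : HasDirectionalDerivs g) (hc : 0 ≤ c) (hcK : c ≤ K)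
    (hbound : bcNorm (derivForm g - K • idForm d) ≤ ENNReal.ofReal c) (X Y : W.SA d) :
    0 ≤ (tinner (toTuple Y) (dirDeriv g X Y)).re := by
  set s := √(tinner (toTuple Y) (toTuple Y)).re with hs
  have hss : s * s = (tinner (toTuple Y) (toTuple Y)).re :=
    Real.mul_self_sqrt (tinner_self_nonneg _)
  have h1 := norm_tinner_le (toTuple Y) (dirDeriv g X Y - K • toTuple Y)
  have h2 := sqrt_tinner_dirDeriv_sub_le hg hc hbound X Y
  rw [← hs] at h1 h2
  have h3 : ‖tinner (toTuple Y) (dirDeriv g X Y - K • toTuple Y)‖ ≤ s * (c * s) :=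
    h1.trans (mul_le_mul_of_nonneg_left h2 (Real.sqrt_nonneg _))
  have h4 := (abs_le.1 ((Complex.abs_re_le_norm _).trans h3)).1
  rw [tinner_sub_right, tinner_smul_right, Complex.sub_re, Complex.re_ofReal_mul, ← hss] at h4
  nlinarith [mul_self_nonneg s]

/-- The map whose fixed points are the solutions `Z` of `g(Z) = Y`. -/
def solveStep (g : NCVec d d) (K : ℝ) (Y Z : W.SA d) : W.SA d := Z - K⁻¹ • (g W Z - Y)

theorem solveStep_eq_iff (hK : K ≠ 0) (Y Z : W.SA d) : solveStep g K Y Z = Z ↔ g W Z = Y := by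
  rw [solveStep, sub_eq_self, smul_eq_zero, sub_eq_zero, or_iff_right (inv_ne_zero hK)]

theorem contractingWith_solveStep (hg : HasDirectionalDerivs g) (hc : 0 ≤ c) (hcK : c < K)
    (hbound : bcNorm (derivForm g - K • idForm d) ≤ ENNReal.ofReal c) (Y : W.SA d) :
    ContractingWith (c / K).toNNReal (solveStep g K Y) := by
  have hK : 0 < K := hc.trans_lt hcK
  refine ⟨by rw [Real.toNNReal_lt_one, div_lt_one hK]; exact hcK,
    LipschitzWith.of_dist_le' fun Z Z' => ?_⟩
  rw [dist_eq_norm, dist_eq_norm]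
  set V := Z - Z' with hV
  have hder : ∀ t : ℝ, HasDerivAt (fun t : ℝ => toTuple (solveStep g K Y (Z' + t • V)))
      (toTuple V - K⁻¹ • dirDeriv g (Z' + t • V) V) t := fun t => by
    have h1 := ((hg.hasDerivAt Z' V t).sub_const (toTuple Y)).const_smul K⁻¹
    have h2 : HasDerivAt (fun t : ℝ => toTuple Z' + t • toTuple V) (toTuple V) t := by
      simpa using ((hasDerivAt_id t).smul_const (toTuple V)).const_add (toTuple Z')
    exact h2.sub h1
  have hle : ∀ t : ℝ, ‖toTuple V - K⁻¹ • dirDeriv g (Z' + t • V) V‖ ≤ c / K * ‖toTuple V‖ := by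
    intro t
    have e : toTuple V - K⁻¹ • dirDeriv g (Z' + t • V) V =
        (-K⁻¹) • (dirDeriv g (Z' + t • V) V - K • toTuple V) := by
      rw [smul_sub (-K⁻¹), smul_smul, neg_mul, inv_mul_cancel₀ hK.ne']
      module
    rw [e, norm_smul, norm_neg, norm_inv, Real.norm_of_nonneg hK.le, div_eq_inv_mul, mul_assoc]
    exact mul_le_mul_of_nonneg_left (norm_dirDeriv_sub_le hg hc hbound _ V) (inv_nonneg.2 hK.le)
  have h := norm_image_sub_le_of_norm_deriv_le_segment_01'
    (fun t _ => (hder t).hasDerivWithinAt) fun t _ => hle t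
  have e1 : Z' + (1 : ℝ) • V = Z := by rw [one_smul, hV]; abel
  have e0 : Z' + (0 : ℝ) • V = Z' := by rw [zero_smul, add_zero]
  rw [e1, e0, ← toTuple_sub, norm_toTuple, norm_toTuple] at h
  exact h

/-- The first order characterization of convexity, for `φ` with gradient `g`. -/
theorem add_tinner_le_of_isGradientAt {φ : NCFun d} (hφ : ∀ X : W.SA d, IsGradientAt φ W X (g W X))
    (hg : HasDirectionalDerivs g) (hc : 0 ≤ c) (hcK : c ≤ K)
    (hbound : bcNorm (derivForm g - K • idForm d) ≤ ENNReal.ofReal c) (X Z : W.SA d) :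
    (W.τ (φ W Z)).re + (tinner (toTuple (X - Z)) (toTuple (g W Z))).re ≤ (W.τ (φ W X)).re := by
  set Y := X - Z with hY
  set v : ℝ → ℝ := fun t => (tinner (toTuple Y) (toTuple (g W (Z + t • Y)))).re with hv
  have hu : ∀ t : ℝ, HasDerivAt (fun t : ℝ => (W.τ (φ W (Z + t • Y))).re) (v t) t := fun t => by
    have h1 := hasDerivAt_τ (hasDerivAt_line (hφ (Z + t • Y) Y))
    rw [τ_algebraMap] at h1
    exact Complex.reCLM.hasFDerivAt.comp_hasDerivAt t h1
  have hv' : ∀ t : ℝ, HasDerivAt v (tinner (toTuple Y) (dirDeriv g (Z + t • Y) Y)).re t := by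
    intro t
    refine Complex.reCLM.hasFDerivAt.comp_hasDerivAt t ?_
    unfold tinner
    exact HasDerivAt.fun_sum fun j _ =>
      hasDerivAt_τ ((hasDerivAt_pi.1 (hg.hasDerivAt Z Y t) j).const_mul _)
  have hmono : Monotone v := monotone_of_deriv_nonneg (fun t => (hv' t).differentiableAt)
    fun t => by rw [(hv' t).deriv]; exact tinner_dirDeriv_nonneg hg hc hcK hbound _ Y
  obtain ⟨ξ, hξ, hslope⟩ := exists_hasDerivAt_eq_slope
    (fun t : ℝ => (W.τ (φ W (Z + t • Y))).re) v zero_lt_one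
    (fun t _ => (hu t).continuousAt.continuousWithinAt) fun t _ => hu t
  have h1 := hmono hξ.1.le
  have e1 : Z + (1 : ℝ) • Y = X := by rw [one_smul, hY]; abel
  have e0 : Z + (0 : ℝ) • Y = Z := by rw [zero_smul, add_zero]
  have h0 : v 0 = (tinner (toTuple Y) (toTuple (g W Z))).re := by simp only [hv, e0]
  rw [h0, hslope, e1, e0] at h1
  linarith

end Contraction

/-! ### Pairs of tuples with the same law -/

section Matching

variable {W W' : TracialWStar} {d d' : ℕ}

/-- A closed algebra of pairs of elements with equal traces. It plays the role of the graph of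
a trace-preserving isomorphism between the algebras generated by two tuples of the same law. -/
structure IsMatching (B : Subalgebra ℂ (W.A × W'.A)) : Prop where
  isClosed : IsClosed (B : Set (W.A × W'.A))
  τ_eq : ∀ b ∈ B, W.τ b.1 = W'.τ b.2

theorem NCPoly.map_eval {A A' : Type*} [Ring A] [Algebra ℂ A] [Ring A'] [Algebra ℂ A']
    (φ : A →ₐ[ℂ] A') (X : Fin d → A) (p : NCPoly d) :
    φ (NCPoly.eval X p) = NCPoly.eval (fun j => φ (X j)) p := by
  have : φ.comp (NCPoly.eval X) = NCPoly.eval (fun j => φ (X j)) := by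
    refine MonoidAlgebra.algHom_ext (fun w => ?_) (Subsingleton.elim _ _)
    simp [NCPoly.eval, FreeMonoid.lift_apply, map_list_prod, Function.comp_def]
  exact congrArg (fun ψ : NCPoly d →ₐ[ℂ] A' => ψ p) this

theorem NCPoly.eval_var {A : Type*} [Ring A] [Algebra ℂ A] (X : Fin d → A) (j : Fin d) :
    NCPoly.eval X (MonoidAlgebra.single (FreeMonoid.of j) 1) = X j := by
  simp [NCPoly.eval]

/-- Tuples of the same law are matched. -/
theorem exists_isMatching {Y : W.SA d} {Y' : W'.SA d} (h : law Y = law Y') :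
    ∃ B : Subalgebra ℂ (W.A × W'.A), IsMatching B ∧
      ∀ j, (toTuple Y j, toTuple Y' j) ∈ B := by
  set P : Fin d → W.A × W'.A := fun j => (toTuple Y j, toTuple Y' j) with hP
  refine ⟨(NCPoly.eval P).range.topologicalClosure,
    ⟨Subalgebra.isClosed_topologicalClosure _, fun b hb => ?_⟩, fun j => ?_⟩
  · have hcl : IsClosed {b : W.A × W'.A | W.τ b.1 = W'.τ b.2} :=
      isClosed_eq (continuous_τ.comp continuous_fst) (continuous_τ.comp continuous_snd)
    have hsub : ((NCPoly.eval P).range : Set (W.A × W'.A)) ⊆ {b | W.τ b.1 = W'.τ b.2} := by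
      rintro _ ⟨p, rfl⟩
      have h1 := NCPoly.map_eval (AlgHom.fst ℂ W.A W'.A) P p
      have h2 := NCPoly.map_eval (AlgHom.snd ℂ W.A W'.A) P p
      change W.τ (AlgHom.fst ℂ W.A W'.A (NCPoly.eval P p)) =
        W'.τ (AlgHom.snd ℂ W.A W'.A (NCPoly.eval P p))
      rw [h1, h2]
      exact LinearMap.congr_fun h p
    exact closure_minimal hsub hcl hb
  · exact Subalgebra.le_topologicalClosure _ ⟨_, NCPoly.eval_var P j⟩

variable {B : Subalgebra ℂ (W.A × W'.A)}

theorem lift_mem {V : Type} {X : V → W.A} {X' : V → W'.A} (h : ∀ v, (X v, X' v) ∈ B)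
    (w : FreeMonoid V) : (FreeMonoid.lift X w, FreeMonoid.lift X' w) ∈ B := by
  induction w using FreeMonoid.inductionOn' with
  | one => exact B.one_mem
  | of_mul v w ih =>
    rw [map_mul, map_mul, FreeMonoid.lift_eval_of, FreeMonoid.lift_eval_of]
    exact B.mul_mem (h v) ih

theorem IsMatching.law_eq (hB : IsMatching B) {X : W.SA d} {X' : W'.SA d}
    (h : ∀ j, (toTuple X j, toTuple X' j) ∈ B) : law X = law X' := by
  refine MonoidAlgebra.lhom_ext' fun w => LinearMap.ext_ring ?_
  simpa [law, NCPoly.eval] using hB.τ_eq _ (lift_mem h w)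

theorem IsMatching.eval_monomial_mem (hB : IsMatching B) {V : Type} {X : V → W.A} {X' : V → W'.A}
    (h : ∀ v, (X v, X' v) ∈ B) (m : TraceMonomial V) : (m.eval X, m.eval X') ∈ B := by
  have e : (m.traced.map fun w => W'.τ (FreeMonoid.lift X' w)) =
      m.traced.map fun w => W.τ (FreeMonoid.lift X w) :=
    List.map_congr_left fun w _ => (hB.τ_eq _ (lift_mem h w)).symm
  rw [TraceMonomial.eval, TraceMonomial.eval, e]
  exact B.smul_mem (lift_mem h m.word) _

theorem IsMatching.eval_mem (hB : IsMatching B) {V : Type} {X : V → W.A} {X' : V → W'.A}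
    (h : ∀ v, (X v, X' v) ∈ B) (g : TracePoly V) : (g.eval X, g.eval X') ∈ B := by
  induction g using Finsupp.induction_linear with
  | zero => exact B.zero_mem
  | add f g hf hg =>
    rw [TracePoly.eval_add, TracePoly.eval_add]
    exact B.add_mem hf hg
  | single m c =>
    rw [TracePoly.eval_single, TracePoly.eval_single]
    exact B.smul_mem (hB.eval_monomial_mem h m) c

theorem IsMatching.mem_of_approx (hB : IsMatching B) {b : W.A × W'.A}
    (h : ∀ ε > 0, ∃ e ∈ B, ‖b.1 - e.1‖ ≤ ε ∧ ‖b.2 - e.2‖ ≤ ε) : b ∈ B := by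
  refine hB.isClosed.closure_subset (Metric.mem_closure_iff.2 fun ε hε => ?_)
  obtain ⟨e, he, h1, h2⟩ := h (ε / 2) (by positivity)
  refine ⟨e, he, lt_of_le_of_lt ?_ (half_lt_self hε)⟩
  rw [dist_eq_norm]
  exact max_le h1 h2

/-- The functions in `C_tr` respect matchings. -/
theorem IsMatching.apply_mem (hB : IsMatching B) {F : NCForm d 0 1} (hF : IsCtr F) {X : W.SA d}
    {X' : W'.SA d} (h : ∀ j, (toTuple X j, toTuple X' j) ∈ B) :
    (F W X Fin.elim0 0, F W' X' Fin.elim0 0) ∈ B := by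
  refine hB.mem_of_approx fun ε hε => ?_
  obtain ⟨g, -, hg⟩ := hF.exists_lpNorm_sub_le (R := ‖toTuple X‖ + ‖toTuple X'‖ + 1)
    (by positivity) hε
  have hg' : ∀ (W : TracialWStar) (X₀ : W.SA d), ‖toTuple X₀‖ ≤ ‖toTuple X‖ + ‖toTuple X'‖ + 1 →
      ‖F W X₀ Fin.elim0 0 - (g 0).eval (formArg X₀ Fin.elim0)‖ ≤ ε := fun W X₀ hX₀ => by
    have h1 := hg W X₀ hX₀ ∞ Fin.elim0 le_top (fun i => i.elim0) (by simp) Fin.elim0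
      fun i => i.elim0
    rw [lpNorm_top] at h1
    exact (norm_le_pi_norm _ 0).trans h1
  refine ⟨_, hB.eval_mem (X := formArg X Fin.elim0) (X' := formArg X' Fin.elim0) ?_ (g 0),
    hg' W X (by linarith [norm_nonneg (toTuple X')]),
    hg' W' X' (by linarith [norm_nonneg (toTuple X)])⟩
  rintro (v | ⟨i, -⟩)
  · exact h v
  · exact i.elim0

/-- Locally uniform limits of trace polynomials respect matchings. -/
theorem IsMatching.vec_mem (hB : IsMatching B) {g : NCVec d d'}
    (hg : ∀ R : ℝ, 0 < R → ∀ ε : ℝ, 0 < ε → ∃ H : Fin d' → TracePoly (FormVar d 1),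
      ∀ (W : TracialWStar) (X : W.SA d), ‖toTuple X‖ ≤ R → ∀ j,
        ‖toTuple (g W X) j - (H j).eval (formArg X 0)‖ ≤ ε) {X : W.SA d}
    {X' : W'.SA d} (h : ∀ j, (toTuple X j, toTuple X' j) ∈ B) (j : Fin d') :
    (toTuple (g W X) j, toTuple (g W' X') j) ∈ B := by
  refine hB.mem_of_approx fun ε hε => ?_
  obtain ⟨H, hH⟩ := hg (‖toTuple X‖ + ‖toTuple X'‖ + 1) (by positivity) ε hε
  refine ⟨_, hB.eval_mem (X := formArg X (0 : Fin 1 → W.SA d))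
    (X' := formArg X' (0 : Fin 1 → W'.SA d)) ?_ (H j),
    hH W X (by linarith [norm_nonneg (toTuple X')]) j,
    hH W' X' (by linarith [norm_nonneg (toTuple X)]) j⟩
  rintro (v | p)
  · exact h v
  · exact B.zero_mem

theorem IsMatching.tinner_eq (hB : IsMatching B) {X Y : W.SA d} {X' Y' : W'.SA d}
    (hX : ∀ j, (toTuple X j, toTuple X' j) ∈ B) (hY : ∀ j, (toTuple Y j, toTuple Y' j) ∈ B) :
    tinner (toTuple X) (toTuple Y) = tinner (toTuple X') (toTuple Y') := by
  refine Finset.sum_congr rfl fun j _ => ?_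
  have e : star (toTuple X j) = toTuple X j := (X j).2.star_eq
  have e' : star (toTuple X' j) = toTuple X' j := (X' j).2.star_eq
  rw [e, e']
  exact hB.τ_eq _ (B.mul_mem (hX j) (hY j))

end Matching

/-! ### Optimality of the gradient coupling -/

section Optimality

variable {d : ℕ}

/-- The properties of a uniformly convex `φ` and its gradient `g` on which optimality rests: `g` is a
locally uniform limit of trace polynomials with `‖∂g - K Id‖ ≤ c < K`, and the values of `φ` depend
on laws only. -/
structure IsConvexGradient (φ : NCFun d) (g : NCVec d d) (K c : ℝ) : Prop where
  nonneg : 0 ≤ c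
  lt : c < K
  approx : ∀ R : ℝ, 0 < R → ∀ ε : ℝ, 0 < ε → ∃ H : Fin d → TracePoly (FormVar d 1),
    ∀ (W : TracialWStar) (X : W.SA d), ‖toTuple X‖ ≤ R → ∀ j,
      ‖toTuple (g W X) j - (H j).eval (formArg X 0)‖ ≤ ε
  isGradientAt : ∀ (W : TracialWStar) (X : W.SA d), IsGradientAt φ W X (g W X)
  derivs : HasDirectionalDerivs g
  bound : bcNorm (derivForm g - K • idForm d) ≤ ENNReal.ofReal c
  law_congr : ∀ (W W' : TracialWStar) (X : W.SA d) (X' : W'.SA d), law X = law X' →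
    W.τ (φ W X) = W'.τ (φ W' X')

variable {φ : NCFun d} {g : NCVec d d} {K c : ℝ}

theorem IsConvexGradient.law_apply (h : IsConvexGradient φ g K c) {W W' : TracialWStar}
    {X : W.SA d} {X' : W'.SA d} (hX : law X = law X') : law (g W X) = law (g W' X') := by
  obtain ⟨B, hB, hBX⟩ := exists_isMatching hX
  exact hB.law_eq (hB.vec_mem h.approx hBX)

/-- The equation `g(Z) = Y'` is solvable in every algebra, and the solution is matched with `X` as
soon as `Y'` is matched with `g(X)`: both are limits of the same fixed point iteration. -/
theorem IsConvexGradient.exists_preimage (h : IsConvexGradient φ g K c) {W W' : TracialWStar}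
    {B : Subalgebra ℂ (W.A × W'.A)} (hB : IsMatching B) {X : W.SA d} {Y' : W'.SA d}
    (hY : ∀ j, (toTuple (g W X) j, toTuple Y' j) ∈ B) :
    ∃ Z : W'.SA d, g W' Z = Y' ∧ ∀ j, (toTuple X j, toTuple Z j) ∈ B := by
  have hK : K ≠ 0 := (h.nonneg.trans_lt h.lt).ne'
  have hc := contractingWith_solveStep (W := W) h.derivs h.nonneg h.lt h.bound (g W X)
  have hc' := contractingWith_solveStep (W := W') h.derivs h.nonneg h.lt h.bound Y'
  have hX : X = hc.fixedPoint _ :=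
    hc.fixedPoint_unique ((solveStep_eq_iff hK _ _).2 rfl)
  have hmem : ∀ (n : ℕ) (j : Fin d), (toTuple ((solveStep g K (g W X))^[n] 0) j,
      toTuple ((solveStep g K Y')^[n] 0) j) ∈ B := by
    intro n
    induction n with
    | zero => exact fun j => B.zero_mem
    | succ n ih =>
      intro j
      rw [Function.iterate_succ_apply', Function.iterate_succ_apply']
      exact B.sub_mem (ih j)
        (B.smul_mem (B.sub_mem (hB.vec_mem h.approx ih j) (hY j)) ((K⁻¹ : ℝ) : ℂ))
  refine ⟨hc'.fixedPoint _, (solveStep_eq_iff hK _ _).1 hc'.fixedPoint_isFixedPt, fun j => ?_⟩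
  have t1 := hc.tendsto_iterate_fixedPoint 0
  rw [← hX] at t1
  have t2 := hc'.tendsto_iterate_fixedPoint 0
  have t1' := ((continuous_apply j).comp continuous_toTuple).continuousAt.tendsto.comp t1
  have t2' := ((continuous_apply j).comp continuous_toTuple).continuousAt.tendsto.comp t2
  exact hB.isClosed.mem_of_tendsto (t1'.prodMk_nhds t2')
    (Filter.Eventually.of_forall fun n => hmem n j)

theorem IsConvexGradient.tinner_le (h : IsConvexGradient φ g K c) {W W' : TracialWStar}
    {X : W.SA d} {X' Y' : W'.SA d} (hX : law X = law X') (hY : law (g W X) = law Y') :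
    (tinner (toTuple X') (toTuple Y')).re ≤ (tinner (toTuple X) (toTuple (g W X))).re := by
  obtain ⟨B, hB, hBY⟩ := exists_isMatching hY
  obtain ⟨Z, rfl, hXZ⟩ := h.exists_preimage hB hBY
  have h1 := add_tinner_le_of_isGradientAt (h.isGradientAt W') h.derivs h.nonneg h.lt.le h.bound
    X' Z
  rw [h.law_congr W' W' Z X' ((hB.law_eq hXZ).symm.trans hX), toTuple_sub, tinner_sub_left,
    Complex.sub_re] at h1
  rw [hB.tinner_eq hXZ hBY]
  linarith

theorem tinner_self_of_law_eq {W W' : TracialWStar} {X : W.SA d} {X' : W'.SA d}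
    (hX : law X = law X') :
    tinner (toTuple X) (toTuple X) = tinner (toTuple X') (toTuple X') := by
  obtain ⟨B, hB, hBX⟩ := exists_isMatching hX
  exact hB.tinner_eq hBX hBX

theorem IsConvexGradient.couplingDist_eq (h : IsConvexGradient φ g K c) {W : TracialWStar}
    (X : W.SA d) :
    couplingDist (law X) (law (g W X)) = lpNorm 2 (toTuple X - toTuple (g W X)) := by
  refine IsLeast.csInf_eq ⟨⟨W, X, g W X, rfl, rfl, rfl⟩, ?_⟩
  rintro _ ⟨W', X', Y', hX, hY, rfl⟩
  rw [lpNorm_two, lpNorm_two]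
  refine Real.sqrt_le_sqrt ?_
  rw [tinner_sub_sub_self_re, tinner_sub_sub_self_re, tinner_self_of_law_eq hX,
    tinner_self_of_law_eq hY]
  have := h.tinner_le hX.symm hY.symm
  linarith

/-- The constant `c` is the norm `‖∂∇φ - K Id‖` itself. -/
theorem isConvexGradient_ncGradient {k : ℕ∞} (hk : 2 ≤ k) (hφ : IsTrCtrKSelfAdjoint k φ)
    (hbound : bcNorm (derivForm (ncGradient φ) - K • idForm d) < ENNReal.ofReal K) :
    ∃ c, IsConvexGradient φ (ncGradient φ) K c := by
  obtain ⟨⟨f, ⟨F, h0, hF, hd⟩, rfl⟩, hsa⟩ := hφ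
  have hF0 := hF 0 (by simp)
  have hF1 := hF 1 (le_trans (by norm_num) hk)
  have hF2 := hF 2 (le_trans (by norm_num) hk)
  have hd0 := hd 0 (le_trans (by norm_num) hk)
  have hd1 := hd 1 (le_trans (by norm_num) hk)
  obtain ⟨hgrad, hτ, happ⟩ := isGradientAt_ncGradient_trFun h0 hF1 hd0 hsa
  set b := bcNorm (derivForm (ncGradient (trFun f)) - K • idForm d) with hb
  have hbtop : b ≠ ∞ := ne_top_of_lt hbound
  refine ⟨b.toReal, ENNReal.toReal_nonneg, ?_, happ, hgrad,
    differentiableAt_ncGradient_trFun hF2 hd1 hτ, (ENNReal.ofReal_toReal hbtop).ge, ?_⟩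
  · exact (ENNReal.lt_ofReal_iff_toReal_lt hbtop).1 hbound
  · intro W W' X X' hX
    obtain ⟨B, hB, hBX⟩ := exists_isMatching hX
    have := hB.τ_eq _ (hB.apply_mem hF0 hBX)
    rw [h0, h0] at this
    rw [trFun, trFun, τ_algebraMap, τ_algebraMap]
    exact this

/-- The choices of a tuple in `pushforward` and `lawEval` are the same. -/
theorem exists_pushforward_eq (g : NCVec d d) {μ : NCPoly d →ₗ[ℂ] ℂ}
    (hμ : ∃ r : Σ W : TracialWStar, W.SA d, law r.2 = μ) :
    ∃ (W : TracialWStar) (X : W.SA d), law X = μ ∧ pushforward g μ = law (g W X) ∧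
      ∀ f : NCFun d, lawEval μ f = W.τ (f W X) := by
  refine ⟨hμ.choose.1, hμ.choose.2, hμ.choose_spec, ?_, fun f => ?_⟩
  · rw [pushforward, dif_pos hμ]
  · rw [lawEval, dif_pos hμ]

theorem IsConvexGradient.isOptimalCoupling (h : IsConvexGradient φ g K c) {W : TracialWStar}
    (X : W.SA d) : IsOptimalCoupling X (g W X) (law X) (pushforward g (law X)) := by
  obtain ⟨W₀, X₀, hX₀, hp, -⟩ := exists_pushforward_eq g (μ := law X) ⟨⟨W, X⟩, rfl⟩
  have h1 : pushforward g (law X) = law (g W X) := hp.trans (h.law_apply hX₀)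
  rw [h1]
  exact ⟨rfl, rfl, (h.couplingDist_eq X).symm⟩

theorem IsConvexGradient.couplingDist_pushforward (h : IsConvexGradient φ g K c)
    {μ : NCPoly d →ₗ[ℂ] ℂ} (hμ : ∃ r : Σ W : TracialWStar, W.SA d, law r.2 = μ) :
    couplingDist μ (pushforward g μ) = Real.sqrt (lawEval μ
      (trInnerFun (fun W X => g W X - X) (fun W X => g W X - X))).re := by
  obtain ⟨W, X, rfl, hp, hl⟩ := exists_pushforward_eq g hμ
  rw [hp, hl, h.couplingDist_eq, lpNorm_two, trInnerFun, τ_algebraMap, tinner_sub_sub_self_re,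
    toTuple_sub, tinner_sub_sub_self_re, 
    ← conj_tinner (toTuple X) (toTuple (g W X)), Complex.conj_re]
  congr 1
  ring

end Optimality

/-! ### The `σ`-weak operator topology -/

section SigmaWeakTopology

variable {H : Type} [NormedAddCommGroup H] [InnerProductSpace ℂ H]

theorem continuous_sigmaWOT_inner_self (ξ : H) :
    Continuous[sigmaWOT H, inferInstance] fun T : H →L[ℂ] H => inner ℂ ξ (T ξ) := by
  have hs : Summable fun j : ℕ => ‖(Pi.single 0 ξ : ℕ → H) j‖ ^ 2 :=
    summable_of_ne_finset_zero (s := {0}) fun j hj => by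
      rw [Pi.single_eq_of_ne (by simpa using hj)]; simp
  have h : Continuous[sigmaWOT H, inferInstance] fun T : H →L[ℂ] H =>
      ∑' j, inner ℂ ((Pi.single 0 ξ : ℕ → H) j) (T ((Pi.single 0 ξ : ℕ → H) j)) :=
    continuous_iInf_dom (i := ⟨Pi.single 0 ξ, hs⟩) continuous_induced_dom
  convert h using 2 with T
  rw [tsum_eq_single 0 fun j hj => by rw [Pi.single_eq_of_ne hj]; simp]
  simp

theorem continuous_sigmaWOT_inner (ξ η : H) :
    Continuous[sigmaWOT H, inferInstance] fun T : H →L[ℂ] H => inner ℂ ξ (T η) := by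
  let : TopologicalSpace (H →L[ℂ] H) := sigmaWOT H
  have h := fun ζ : H => continuous_sigmaWOT_inner_self ζ
  have e : (fun T : H →L[ℂ] H => inner ℂ ξ (T η)) = fun T =>
      (inner ℂ (η + ξ) (T (η + ξ)) - inner ℂ (η - ξ) (T (η - ξ)) +
        Complex.I * inner ℂ (η + Complex.I • ξ) (T (η + Complex.I • ξ)) -
        Complex.I * inner ℂ (η - Complex.I • ξ) (T (η - Complex.I • ξ))) / 4 := by
    funext T
    simp only [map_add, map_sub, map_smul, inner_add_left, inner_add_right, inner_sub_left,
      inner_sub_right, inner_smul_left, inner_smul_right, Complex.conj_I]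
    linear_combination ((1 / 2 : ℂ) * inner ℂ ξ (T η) - (1 / 2 : ℂ) * inner ℂ η (T ξ)) *
      Complex.I_mul_I
  rw [e]
  exact ((((h _).sub (h _)).add (continuous_const.mul (h _))).sub
    (continuous_const.mul (h _))).div_const 4

/-- On a separable Hilbert space, every set of operators is separable in the `σ`-weak operator
topology. On bounded sets this topology is coarser than the second countable one given by the
functionals `T ↦ ⟪e, T e⟫`, for `e` in a countable dense set. -/
theorem separableSpace_induced_sigmaWOT [TopologicalSpace.SeparableSpace H] {α : Type}
    (i : α → H →L[ℂ] H) :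
    @TopologicalSpace.SeparableSpace α (TopologicalSpace.induced i (sigmaWOT H)) := by
  let : TopologicalSpace α := TopologicalSpace.induced i (sigmaWOT H)
  have hball : ∀ n : ℕ, TopologicalSpace.IsSeparable {a : α | ‖i a‖ ≤ n} := by
    intro n
    let β := {a : α // ‖i a‖ ≤ n}
    let Φ : β → ℕ → ℂ := fun a k =>
      inner ℂ (TopologicalSpace.denseSeq H k) (i a.1 (TopologicalSpace.denseSeq H k))
    let t : TopologicalSpace β := TopologicalSpace.induced Φ inferInstance
    have hsc : @SecondCountableTopology β t :=
      TopologicalSpace.secondCountableTopology_induced _ _ _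
    have hΦ : ∀ k, Continuous[t, inferInstance] fun a => Φ a k := fun k => by
      let := t
      exact (continuous_apply k).comp (continuous_induced_dom (f := Φ))
    have hinner : ∀ ξ : H, Continuous[t, inferInstance] fun a : β => inner ℂ ξ (i a.1 ξ) := by
      intro ξ
      let := t
      refine continuous_of_uniform_approx_of_continuous fun u hu => ?_
      obtain ⟨ε, hε, hεu⟩ := Metric.mem_uniformity_dist.1 hu
      have hcont : Continuous fun e : H => (n : ℝ) * (‖ξ‖ + ‖e‖) * ‖ξ - e‖ := by fun_prop
      obtain ⟨k, hk⟩ := (TopologicalSpace.denseRange_denseSeq H).exists_mem_open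
        (hcont.isOpen_preimage (Set.Iio ε) isOpen_Iio) ⟨ξ, by simpa using hε⟩
      refine ⟨fun a => Φ a k, hΦ k, fun a => hεu ?_⟩
      refine lt_of_le_of_lt ?_ hk
      set e := TopologicalSpace.denseSeq H k
      have e1 : inner ℂ ξ (i a.1 ξ) - inner ℂ e (i a.1 e) =
          inner ℂ ξ (i a.1 (ξ - e)) + inner ℂ (ξ - e) (i a.1 e) := by
        rw [map_sub, inner_sub_right, inner_sub_left]; ring
      have hop : ∀ ζ, ‖i a.1 ζ‖ ≤ n * ‖ζ‖ := fun ζ =>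
        ((i a.1).le_opNorm ζ).trans (mul_le_mul_of_nonneg_right a.2 (norm_nonneg _))
      rw [dist_eq_norm, e1]
      calc _ ≤ ‖ξ‖ * ‖i a.1 (ξ - e)‖ + ‖ξ - e‖ * ‖i a.1 e‖ :=
            (norm_add_le _ _).trans (add_le_add (norm_inner_le_norm _ _) (norm_inner_le_norm _ _))
        _ ≤ ‖ξ‖ * (n * ‖ξ - e‖) + ‖ξ - e‖ * (n * ‖e‖) := by
            gcongr
            · exact hop _
            · exact hop _
        _ = _ := by ring
    have hval : Continuous[t, inferInstance] (Subtype.val : β → α) := by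
      let := t
      refine continuous_induced_rng.2 (continuous_iInf_rng.2 fun ξ => continuous_induced_rng.2 ?_)
      refine continuous_tsum (u := fun j => n * ‖ξ.1 j‖ ^ 2) (fun j => hinner (ξ.1 j))
        (ξ.2.mul_left _) fun j a => ?_
      calc _ ≤ ‖ξ.1 j‖ * (n * ‖ξ.1 j‖) := (norm_inner_le_norm _ _).trans <|
            mul_le_mul_of_nonneg_left (((i a.1).le_opNorm _).trans
              (mul_le_mul_of_nonneg_right a.2 (norm_nonneg _))) (norm_nonneg _)
        _ = _ := by ring
    have hr : Set.range (Subtype.val : β → α) = {a : α | ‖i a‖ ≤ n} := Subtype.range_val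
    rw [← hr]
    let := t
    exact TopologicalSpace.isSeparable_range hval
  rw [← TopologicalSpace.isSeparable_univ_iff]
  have hU : (Set.univ : Set α) = ⋃ n : ℕ, {a | ‖i a‖ ≤ n} := by
    symm
    rw [Set.eq_univ_iff_forall]
    intro a
    obtain ⟨n, hn⟩ := exists_nat_ge ‖i a‖
    exact Set.mem_iUnion.2 ⟨n, hn⟩
  rw [hU]
  exact TopologicalSpace.IsSeparable.iUnion hball

end SigmaWeakTopology

/-! ### The involution on non-commutative polynomials -/

namespace NCPoly

variable {d : ℕ}

theorem conjStar_single (w : FreeMonoid (Fin d)) (c : ℂ) :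
    conjStar (MonoidAlgebra.single w c) =
      MonoidAlgebra.single (star w) (starRingEnd ℂ c) := by
  refine Finsupp.sum_single_index ?_
  simp

theorem conjStar_zero : conjStar (0 : NCPoly d) = 0 := Finsupp.sum_zero_index

theorem conjStar_add (p q : NCPoly d) : conjStar (p + q) = conjStar p + conjStar q :=
  Finsupp.sum_add_index' (fun _ => by simp) fun _ _ _ => by simp

theorem conjStar_smul (c : ℂ) (p : NCPoly d) :
    conjStar (c • p) = starRingEnd ℂ c • conjStar p := by
  induction p using MonoidAlgebra.induction_linear with
  | zero => rw [smul_zero, conjStar_zero, smul_zero]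
  | add p q hp hq => rw [smul_add, conjStar_add, conjStar_add, hp, hq, smul_add]
  | single w a => simp [conjStar_single]

theorem conjStar_mul (p q : NCPoly d) : conjStar (p * q) = conjStar q * conjStar p := by
  induction p using MonoidAlgebra.induction_linear with
  | zero => simp [conjStar_zero]
  | add p p' hp hp' => rw [add_mul, conjStar_add, hp, hp', conjStar_add, mul_add]
  | single w a =>
    induction q using MonoidAlgebra.induction_linear with
    | zero => simp [conjStar_zero]
    | add q q' hq hq' => rw [mul_add, conjStar_add, hq, hq', conjStar_add, add_mul]
    | single w' a' => simp [conjStar_single, MonoidAlgebra.single_mul_single, mul_comm]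

theorem conjStar_conjStar (p : NCPoly d) : conjStar (conjStar p) = p := by
  induction p using MonoidAlgebra.induction_linear with
  | zero => simp [conjStar_zero]
  | add p p' hp hp' => rw [conjStar_add, conjStar_add, hp, hp']
  | single w a => simp [conjStar_single]

theorem conjStar_one : conjStar (1 : NCPoly d) = 1 := by
  rw [MonoidAlgebra.one_def, conjStar_single]; simp

/-- The variable `xⱼ`. -/
def var (j : Fin d) : NCPoly d := MonoidAlgebra.single (FreeMonoid.of j) 1

theorem conjStar_var (j : Fin d) : conjStar (var j) = var j := by
  simp [var, conjStar_single]

end NCPoly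

/-! ### The Gelfand–Naimark–Segal construction for a non-commutative law -/

/-- A symmetric linear map with `‖Tⁿ x‖ = O(Rⁿ)` for each `x` is bounded by `R`, since
`‖T x‖ ^ (2 ^ n) ≤ ‖T ^ (2 ^ n) x‖ ‖x‖ ^ (2 ^ n - 1)` by the Cauchy–Schwarz inequality. -/
theorem norm_apply_le_of_pow_bound {E : Type*} [SeminormedAddCommGroup E] [InnerProductSpace ℂ E]
    (T : E →ₗ[ℂ] E) (hT : ∀ x y, inner ℂ (T x) y = inner ℂ x (T y)) {R : ℝ} (hR : 0 < R) (x : E)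
    (h : ∃ C : ℝ, ∀ n : ℕ, ‖(T ^ n) x‖ ≤ C * R ^ n) : ‖T x‖ ≤ R * ‖x‖ := by
  obtain ⟨C, hC⟩ := h
  have hTn : ∀ (n : ℕ) (x y : E), inner ℂ ((T ^ n) x) y = inner ℂ x ((T ^ n) y) := by
    intro n
    induction n with
    | zero => simp
    | succ n ih =>
      intro x y
      rw [pow_succ, Module.End.mul_apply, ih, hT, ← Module.End.mul_apply, ← pow_succ', pow_succ]
  have hstep : ∀ n : ℕ, ‖(T ^ n) x‖ ^ 2 ≤ ‖(T ^ (2 * n)) x‖ * ‖x‖ := fun n => by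
    have h1 : inner ℂ ((T ^ (2 * n)) x) x = (‖(T ^ n) x‖ : ℂ) ^ 2 := by
      rw [two_mul, pow_add, Module.End.mul_apply, hTn, inner_self_eq_norm_sq_to_K]
      rfl
    have h2 := norm_inner_le_norm (𝕜 := ℂ) ((T ^ (2 * n)) x) x
    rw [h1] at h2
    simpa using h2
  rcases (norm_nonneg x).eq_or_lt with hx | hx
  · have := hstep 1
    rw [← hx, mul_zero, pow_one] at this
    rw [← hx, mul_zero]
    nlinarith [norm_nonneg (T x)]
  · have hpow : ∀ n : ℕ, ‖T x‖ ^ (2 ^ n) * ‖x‖ ≤ ‖(T ^ (2 ^ n)) x‖ * ‖x‖ ^ (2 ^ n) := by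
      intro n
      induction n with
      | zero => simp
      | succ n ih =>
        have h1 := hstep (2 ^ n)
        have h2 : (‖T x‖ ^ (2 ^ n) * ‖x‖) ^ 2 ≤ (‖(T ^ (2 ^ n)) x‖ * ‖x‖ ^ (2 ^ n)) ^ 2 :=
          pow_le_pow_left₀ (by positivity) ih 2
        have h3 : (‖T x‖ ^ 2 ^ (n + 1) * ‖x‖) * ‖x‖ ≤
            (‖(T ^ 2 ^ (n + 1)) x‖ * ‖x‖ ^ 2 ^ (n + 1)) * ‖x‖ := by
          calc _ = (‖T x‖ ^ (2 ^ n) * ‖x‖) ^ 2 := by ring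
            _ ≤ (‖(T ^ (2 ^ n)) x‖ * ‖x‖ ^ (2 ^ n)) ^ 2 := h2
            _ = ‖(T ^ (2 ^ n)) x‖ ^ 2 * ‖x‖ ^ 2 ^ (n + 1) := by ring
            _ ≤ (‖(T ^ (2 * 2 ^ n)) x‖ * ‖x‖) * ‖x‖ ^ 2 ^ (n + 1) := by gcongr
            _ = _ := by rw [← pow_succ' 2 n]; ring
        exact le_of_mul_le_mul_right h3 hx
    by_contra! hcon
    have ha : 1 < ‖T x‖ / (R * ‖x‖) := (one_lt_div (by positivity)).2 hcon
    have hb : ∀ n : ℕ, (‖T x‖ / (R * ‖x‖)) ^ (2 ^ n) ≤ C / ‖x‖ := fun n => by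
      rw [div_pow, div_le_div_iff₀ (by positivity) hx, mul_pow]
      calc _ ≤ ‖(T ^ (2 ^ n)) x‖ * ‖x‖ ^ (2 ^ n) := hpow n
        _ ≤ (C * R ^ (2 ^ n)) * ‖x‖ ^ (2 ^ n) := by gcongr; exact hC _
        _ = _ := by ring
    obtain ⟨n, hn⟩ := pow_unbounded_of_one_lt (C / ‖x‖) ha
    have := hb n
    have h5 := pow_le_pow_right₀ ha.le (Nat.lt_two_pow_self (n := n)).le
    linarith

namespace IsNCLaw

variable {d : ℕ} {μ : NCPoly d →ₗ[ℂ] ℂ}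

open NCPoly

theorem map_conjStar (hμ : IsNCLaw μ) (p : NCPoly d) :
    μ (conjStar p) = starRingEnd ℂ (μ p) := by
  have h1 := (Complex.le_def.1 (hμ.positive (1 + p))).2
  have h2 := (Complex.le_def.1 (hμ.positive (1 + Complex.I • p))).2
  have h3 := (Complex.le_def.1 (hμ.positive p)).2
  simp only [conjStar_add, conjStar_one, conjStar_smul, add_mul, mul_add, one_mul, mul_one,
    map_add, smul_mul_assoc, mul_smul_comm, map_smul, hμ.unital, Complex.conj_I, smul_eq_mul,
    Complex.add_im, Complex.zero_im, Complex.one_im, Complex.mul_im, Complex.neg_im,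
    Complex.neg_re, Complex.I_re, Complex.I_im, Complex.mul_re] at h1 h2 h3
  apply Complex.ext
  · rw [Complex.conj_re]; linarith
  · rw [Complex.conj_im]; linarith

/-- The algebra of polynomials with the inner product `⟨p, q⟩ = μ(p* q)` of a law `μ`. -/
def PreGNS (_ : IsNCLaw μ) : Type := NCPoly d

variable (hμ : IsNCLaw μ)

instance : AddCommGroup hμ.PreGNS := inferInstanceAs (AddCommGroup (NCPoly d))

instance : Module ℂ hμ.PreGNS := inferInstanceAs (Module ℂ (NCPoly d))

/-- A polynomial as an element of the pre-Hilbert space. -/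
def toPreGNS : NCPoly d ≃ₗ[ℂ] hμ.PreGNS := LinearEquiv.refl ℂ _

/-- The inner product `⟨p, q⟩ = μ(p* q)`. It may be degenerate. -/
@[reducible] def preGNSCore : PreInnerProductSpace.Core ℂ hμ.PreGNS where
  inner p q := μ (conjStar (hμ.toPreGNS.symm p) * hμ.toPreGNS.symm q)
  conj_inner_symm p q := by
    rw [← hμ.map_conjStar, conjStar_mul, conjStar_conjStar]
  re_inner_nonneg p := (Complex.le_def.1 (hμ.positive _)).1
  add_left p q r := by rw [map_add, conjStar_add, add_mul, map_add]
  smul_left p q c := by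
    rw [map_smul, conjStar_smul, smul_mul_assoc, map_smul, smul_eq_mul]

instance : SeminormedAddCommGroup hμ.PreGNS :=
  InnerProductSpace.Core.toSeminormedAddCommGroup (c := hμ.preGNSCore)

instance : InnerProductSpace ℂ hμ.PreGNS := InnerProductSpace.ofCore hμ.preGNSCore

theorem inner_toPreGNS (p q : NCPoly d) :
    inner ℂ (hμ.toPreGNS p) (hμ.toPreGNS q) = μ (conjStar p * q) := rfl

theorem norm_toPreGNS_conjStar (p : NCPoly d) :
    ‖hμ.toPreGNS (conjStar p)‖ = ‖hμ.toPreGNS p‖ := by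
  have h : ‖hμ.toPreGNS (conjStar p)‖ ^ 2 = ‖hμ.toPreGNS p‖ ^ 2 := by
    rw [← inner_self_eq_norm_sq (𝕜 := ℂ), ← inner_self_eq_norm_sq (𝕜 := ℂ), inner_toPreGNS,
      inner_toPreGNS, conjStar_conjStar, hμ.tracial]
  exact (sq_eq_sq₀ (norm_nonneg _) (norm_nonneg _)).1 h

/-- Left multiplication by `p`. -/
def mulLeft (p : NCPoly d) : hμ.PreGNS →ₗ[ℂ] hμ.PreGNS :=
  hμ.toPreGNS.toLinearMap ∘ₗ LinearMap.mulLeft ℂ p ∘ₗ hμ.toPreGNS.symm.toLinearMap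

theorem mulLeft_apply (p q : NCPoly d) :
    hμ.mulLeft p (hμ.toPreGNS q) = hμ.toPreGNS (p * q) := rfl

theorem exists_bound_mul_var_pow_mul (hμ : IsNCLaw μ) :
    ∃ R : ℝ, 0 < R ∧ ∀ (j : Fin d) (p q : NCPoly d),
    ∃ C : ℝ, ∀ n : ℕ, ‖μ (p * var j ^ n * q)‖ ≤ C * R ^ n := by
  obtain ⟨R, hR, hb⟩ := hμ.exp_bounded
  refine ⟨R, hR, fun j p q => ?_⟩
  induction p using MonoidAlgebra.induction_linear with
  | zero => exact ⟨0, fun n => by simp⟩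
  | add p p' hp hp' =>
    obtain ⟨C, hC⟩ := hp
    obtain ⟨C', hC'⟩ := hp'
    refine ⟨C + C', fun n => ?_⟩
    rw [add_mul, add_mul, map_add, add_mul]
    exact (norm_add_le _ _).trans (add_le_add (hC n) (hC' n))
  | single w a =>
    induction q using MonoidAlgebra.induction_linear with
    | zero => exact ⟨0, fun n => by simp⟩
    | add p p' hp hp' =>
      obtain ⟨C, hC⟩ := hp
      obtain ⟨C', hC'⟩ := hp'
      refine ⟨C + C', fun n => ?_⟩
      rw [mul_add, map_add, add_mul]
      exact (norm_add_le _ _).trans (add_le_add (hC n) (hC' n))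
    | single w' a' =>
      refine ⟨‖a * a'‖ * R ^ (w.length + w'.length), fun n => ?_⟩
      have e : (MonoidAlgebra.single w a * var j ^ n * MonoidAlgebra.single w' a' : NCPoly d) =
          (a * a') • MonoidAlgebra.single (w * FreeMonoid.of j ^ n * w') 1 := by
        simp [var, MonoidAlgebra.single_pow, MonoidAlgebra.single_mul_single]
      have hl : (w * FreeMonoid.of j ^ n * w').length = w.length + w'.length + n := by
        have : ∀ n, (FreeMonoid.of j ^ n).length = n := fun n => by
          induction n with
          | zero => simp
          | succ n ih => rw [pow_succ, FreeMonoid.length_mul, ih, FreeMonoid.length_of]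
        rw [FreeMonoid.length_mul, FreeMonoid.length_mul, this]
        ring
      rw [e, map_smul, norm_smul, mul_assoc ‖a * a'‖, ← pow_add, ← hl]
      exact mul_le_mul_of_nonneg_left (hb _) (norm_nonneg _)

/-- Left multiplications are bounded, by the exponential bound on `μ`. -/
theorem exists_norm_mul_le (p : NCPoly d) :
    ∃ C : ℝ, ∀ q : NCPoly d, ‖hμ.toPreGNS (p * q)‖ ≤ C * ‖hμ.toPreGNS q‖ := by
  obtain ⟨R, hR, hb⟩ := hμ.exists_bound_mul_var_pow_mul
  have hvar : ∀ (j : Fin d) (q : NCPoly d),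
      ‖hμ.toPreGNS (var j * q)‖ ≤ R * ‖hμ.toPreGNS q‖ := by
    intro j q
    rw [← mulLeft_apply]
    have hpow : ∀ n : ℕ, (hμ.mulLeft (var j) ^ n) (hμ.toPreGNS q) =
        hμ.toPreGNS (var j ^ n * q) := by
      intro n
      induction n with
      | zero => simp
      | succ n ih => rw [pow_succ', Module.End.mul_apply, ih, mulLeft_apply, pow_succ', mul_assoc]
    refine norm_apply_le_of_pow_bound _ ?_ hR _ ?_
    · intro x y
      obtain ⟨x, rfl⟩ := hμ.toPreGNS.surjective x
      obtain ⟨y, rfl⟩ := hμ.toPreGNS.surjective y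
      rw [mulLeft_apply, mulLeft_apply, inner_toPreGNS, inner_toPreGNS, conjStar_mul,
        conjStar_var, mul_assoc]
    · obtain ⟨C, hC⟩ := hb j (conjStar q) q
      refine ⟨√C, fun n => ?_⟩
      have hC0 : 0 ≤ C := by simpa using (norm_nonneg _).trans (hC 0)
      have hcs : conjStar (var j ^ n) = var j ^ n := by
        induction n with
        | zero => rw [pow_zero, conjStar_one]
        | succ n ih => rw [pow_succ, conjStar_mul, ih, conjStar_var, ← pow_succ', pow_succ]
      have h1 : ‖hμ.toPreGNS (var j ^ n * q)‖ ^ 2 ≤ C * R ^ (2 * n) := by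
        rw [← inner_self_eq_norm_sq (𝕜 := ℂ), inner_toPreGNS, conjStar_mul, hcs]
        have := hC (2 * n)
        rw [two_mul, pow_add] at this
        refine (RCLike.re_le_norm _).trans (le_trans (le_of_eq ?_) (this.trans_eq ?_))
        · simp only [mul_assoc]
        · rw [two_mul]
      rw [hpow]
      refine abs_le_of_sq_le_sq' ?_ (by positivity) |>.2
      rw [mul_pow, Real.sq_sqrt hC0, ← pow_mul, mul_comm n]
      exact h1
  induction p using MonoidAlgebra.induction_linear with
  | zero => exact ⟨0, fun q => by simp⟩
  | add p p' hp hp' =>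
    obtain ⟨C, hC⟩ := hp
    obtain ⟨C', hC'⟩ := hp'
    refine ⟨C + C', fun q => ?_⟩
    rw [add_mul, map_add, add_mul]
    exact (norm_add_le _ _).trans (add_le_add (hC q) (hC' q))
  | single w a =>
    have hw : ∃ C : ℝ, 0 ≤ C ∧ ∀ q : NCPoly d,
        ‖hμ.toPreGNS (MonoidAlgebra.single w 1 * q)‖ ≤ C * ‖hμ.toPreGNS q‖ := by
      induction w using FreeMonoid.inductionOn' with
      | one => exact ⟨1, zero_le_one, fun q => by rw [← MonoidAlgebra.one_def, one_mul, one_mul]⟩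
      | of_mul j w ih =>
        obtain ⟨C, hC0, hC⟩ := ih
        refine ⟨R * C, by positivity, fun q => ?_⟩
        have e : (MonoidAlgebra.single (FreeMonoid.of j * w) 1 : NCPoly d) =
            var j * MonoidAlgebra.single w 1 := by
          rw [var, MonoidAlgebra.single_mul_single, mul_one]
        rw [e, mul_assoc, mul_assoc]
        exact (hvar j _).trans (mul_le_mul_of_nonneg_left (hC q) hR.le)
    obtain ⟨C, -, hC⟩ := hw
    refine ⟨‖a‖ * C, fun q => ?_⟩
    have e : (MonoidAlgebra.single w a : NCPoly d) = a • MonoidAlgebra.single w 1 := by simp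
    rw [e, smul_mul_assoc, map_smul, norm_smul, mul_assoc]
    exact mul_le_mul_of_nonneg_left (hC q) (norm_nonneg _)

end IsNCLaw

namespace IsNCLaw

variable {d : ℕ} {μ : NCPoly d →ₗ[ℂ] ℂ} (hμ : IsNCLaw μ)

open NCPoly UniformSpace

/-- The Gelfand–Naimark–Segal Hilbert space. -/
abbrev GNS : Type := Completion hμ.PreGNS

/-- A polynomial as a vector of the Hilbert space; `vec 1` is the vacuum vector. -/
def vec (p : NCPoly d) : hμ.GNS := (hμ.toPreGNS p : hμ.PreGNS)

/-- Left multiplication, as a bounded operator. -/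
def left (p : NCPoly d) : hμ.GNS →L[ℂ] hμ.GNS :=
  ((hμ.mulLeft p).mkContinuousOfExistsBound (hμ.exists_norm_mul_le p)).completion

/-- Right multiplication, as a bounded operator. -/
def right (p : NCPoly d) : hμ.GNS →L[ℂ] hμ.GNS :=
  ((hμ.toPreGNS.toLinearMap ∘ₗ LinearMap.mulRight ℂ p ∘ₗ
    hμ.toPreGNS.symm.toLinearMap).mkContinuousOfExistsBound <| by
      obtain ⟨C, hC⟩ := hμ.exists_norm_mul_le (conjStar p)
      refine ⟨C, fun q => ?_⟩
      obtain ⟨q, rfl⟩ := hμ.toPreGNS.surjective q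
      have h := hC (conjStar q)
      rw [← conjStar_mul, norm_toPreGNS_conjStar, norm_toPreGNS_conjStar] at h
      exact h).completion

theorem left_vec (p q : NCPoly d) : hμ.left p (hμ.vec q) = hμ.vec (p * q) := by
  rw [left, vec, ContinuousLinearMap.completion_apply_coe]
  rfl

theorem right_vec (p q : NCPoly d) : hμ.right p (hμ.vec q) = hμ.vec (q * p) := by
  rw [right, vec, ContinuousLinearMap.completion_apply_coe]
  rfl

theorem inner_vec (p q : NCPoly d) : inner ℂ (hμ.vec p) (hμ.vec q) = μ (conjStar p * q) := by
  rw [vec, vec, Completion.inner_coe, inner_toPreGNS]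

theorem denseRange_vec : DenseRange hμ.vec :=
  Completion.denseRange_coe.comp hμ.toPreGNS.surjective.denseRange (Completion.continuous_coe _)

theorem inner_right (p : NCPoly d) (ξ η : hμ.GNS) :
    inner ℂ (hμ.right p ξ) η = inner ℂ ξ (hμ.right (conjStar p) η) := by
  refine hμ.denseRange_vec.induction_on₂ (p := fun ξ η =>
    inner ℂ (hμ.right p ξ) η = inner ℂ ξ (hμ.right (conjStar p) η))
    (isClosed_eq (by fun_prop) (by fun_prop)) (fun a b => ?_) ξ η
  rw [right_vec, right_vec, inner_vec, inner_vec, conjStar_mul, mul_assoc, hμ.tracial, mul_assoc]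

theorem inner_left (p : NCPoly d) (ξ η : hμ.GNS) :
    inner ℂ (hμ.left p ξ) η = inner ℂ ξ (hμ.left (conjStar p) η) := by
  refine hμ.denseRange_vec.induction_on₂ (p := fun ξ η =>
    inner ℂ (hμ.left p ξ) η = inner ℂ ξ (hμ.left (conjStar p) η))
    (isClosed_eq (by fun_prop) (by fun_prop)) (fun a b => ?_) ξ η
  rw [left_vec, left_vec, inner_vec, inner_vec, conjStar_mul, mul_assoc]

theorem star_right (p : NCPoly d) : star (hμ.right p) = hμ.right (conjStar p) := by
  rw [ContinuousLinearMap.star_eq_adjoint]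
  symm
  rw [ContinuousLinearMap.eq_adjoint_iff]
  intro ξ η
  rw [inner_right, conjStar_conjStar]

theorem isSelfAdjoint_left_var (j : Fin d) : IsSelfAdjoint (hμ.left (var j)) := by
  rw [ContinuousLinearMap.isSelfAdjoint_iff']
  symm
  rw [ContinuousLinearMap.eq_adjoint_iff]
  intro ξ η
  rw [inner_left, conjStar_var]

/-- The commutant of the right multiplications. It is the von Neumann algebra generated by the left
multiplications, but its definition as a commutant makes it closed, and suffices for its trace. -/
def gnsAlgebra : StarSubalgebra ℂ (hμ.GNS →L[ℂ] hμ.GNS) :=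
  StarSubalgebra.centralizer ℂ (Set.range hμ.right)

theorem mem_gnsAlgebra {T : hμ.GNS →L[ℂ] hμ.GNS} :
    T ∈ hμ.gnsAlgebra ↔ ∀ p ξ, hμ.right p (T ξ) = T (hμ.right p ξ) := by
  rw [gnsAlgebra, StarSubalgebra.mem_centralizer_iff]
  constructor
  · intro h p ξ
    exact congrArg (fun S : hμ.GNS →L[ℂ] hμ.GNS => S ξ) (h _ ⟨p, rfl⟩).1
  · rintro h _ ⟨p, rfl⟩
    rw [star_right]
    exact ⟨ContinuousLinearMap.ext (h p), ContinuousLinearMap.ext (h _)⟩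

theorem left_mem_gnsAlgebra (p : NCPoly d) : hμ.left p ∈ hμ.gnsAlgebra := by
  rw [mem_gnsAlgebra]
  intro q ξ
  refine hμ.denseRange_vec.induction_on (p := fun ξ =>
    hμ.right q (hμ.left p ξ) = hμ.left p (hμ.right q ξ)) ξ
    (isClosed_eq (by fun_prop) (by fun_prop)) fun a => ?_
  rw [right_vec, left_vec, left_vec, right_vec, mul_assoc]

theorem isClosed_gnsAlgebra :
    IsClosed[sigmaWOT hμ.GNS] (hμ.gnsAlgebra : Set (hμ.GNS →L[ℂ] hμ.GNS)) := by
  have e : (hμ.gnsAlgebra : Set (hμ.GNS →L[ℂ] hμ.GNS)) = ⋂ (p : NCPoly d) (ξ : hμ.GNS) (η : hμ.GNS),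
      {T | inner ℂ (hμ.right (conjStar p) η) (T ξ) = inner ℂ η (T (hμ.right p ξ))} := by
    ext T
    simp only [Set.mem_iInter, Set.mem_ofPred_eq, SetLike.mem_coe, mem_gnsAlgebra, inner_right,
      conjStar_conjStar]
    exact forall₂_congr fun p ξ => ext_iff_inner_left ℂ
  rw [e]
  let := sigmaWOT hμ.GNS
  exact isClosed_iInter fun p => isClosed_iInter fun ξ => isClosed_iInter fun η =>
    isClosed_eq (continuous_sigmaWOT_inner _ _) (continuous_sigmaWOT_inner _ _)

instance : TopologicalSpace.SeparableSpace hμ.PreGNS := by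
  have h1 : (Set.range fun w : FreeMonoid (Fin d) =>
      hμ.toPreGNS (MonoidAlgebra.single w 1)).Countable := by
    have : Countable (FreeMonoid (Fin d)) := inferInstanceAs (Countable (List (Fin d)))
    exact Set.countable_range _
  have h2 := (h1.isSeparable.span (R := ℂ))
  rw [← TopologicalSpace.isSeparable_univ_iff]
  refine h2.mono fun x _ => ?_
  obtain ⟨p, rfl⟩ := hμ.toPreGNS.surjective x
  induction p using MonoidAlgebra.induction_linear with
  | zero => simp
  | add p q hp hq =>
    rw [map_add]
    exact Submodule.add_mem _ (hp trivial) (hq trivial)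
  | single w a =>
    have e : (MonoidAlgebra.single w a : NCPoly d) = a • MonoidAlgebra.single w 1 := by simp
    rw [e, map_smul]
    exact Submodule.smul_mem _ _ (Submodule.subset_span ⟨w, rfl⟩)

theorem vec_eq_right (p : NCPoly d) : hμ.vec p = hμ.right p (hμ.vec 1) := by
  rw [right_vec, one_mul]

/-- Weak form of `J T Ω = T* Ω`, where `Ω` is the vacuum vector and `J p = p*`. -/
theorem inner_star_vac {T : hμ.GNS →L[ℂ] hμ.GNS} (hT : T ∈ hμ.gnsAlgebra) (p : NCPoly d) :
    inner ℂ (star T (hμ.vec 1)) (hμ.vec p) = inner ℂ (hμ.vec (conjStar p)) (T (hμ.vec 1)) := by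
  rw [ContinuousLinearMap.star_eq_adjoint, ContinuousLinearMap.adjoint_inner_left,
    vec_eq_right _ p, ← hμ.mem_gnsAlgebra.1 hT, vec_eq_right _ (conjStar p), inner_right,
    conjStar_conjStar]

theorem norm_vec_conjStar (p : NCPoly d) : ‖hμ.vec (conjStar p)‖ = ‖hμ.vec p‖ := by
  rw [vec, vec, Completion.norm_coe, Completion.norm_coe, norm_toPreGNS_conjStar]

theorem vec_sub (p q : NCPoly d) : hμ.vec (p - q) = hμ.vec p - hμ.vec q := by
  rw [vec, vec, vec, map_sub, Completion.coe_sub]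

/-- Polynomials approximating `S Ω` have adjoints approximating `S* Ω`. -/
theorem exists_tendsto_vec {S : hμ.GNS →L[ℂ] hμ.GNS} (hS : S ∈ hμ.gnsAlgebra) :
    ∃ p : ℕ → NCPoly d,
      Filter.Tendsto (fun n => hμ.vec (p n)) Filter.atTop (𝓝 (S (hμ.vec 1))) ∧
      Filter.Tendsto (fun n => hμ.vec (conjStar (p n))) Filter.atTop
        (𝓝 (star S (hμ.vec 1))) := by
  obtain ⟨u, hu, hlim⟩ := mem_closure_iff_seq_limit.1 (hμ.denseRange_vec (S (hμ.vec 1)))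
  choose p hp using hu
  obtain rfl : (fun n => hμ.vec (p n)) = u := funext hp
  refine ⟨p, hlim, ?_⟩
  have hneg : ∀ q : NCPoly d, conjStar (-q) = -conjStar q := fun q => by
    rw [← neg_one_smul ℂ q, conjStar_smul]; simp
  have hcau : CauchySeq fun n => hμ.vec (conjStar (p n)) := by
    rw [Metric.cauchySeq_iff]
    intro ε hε
    obtain ⟨N, hN⟩ := Metric.cauchySeq_iff.1 hlim.cauchySeq ε hε
    refine ⟨N, fun m hm n hn => ?_⟩
    have h1 := hN m hm n hn
    rw [dist_eq_norm] at h1 ⊢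
    rwa [← vec_sub, sub_eq_add_neg, ← hneg, ← conjStar_add, ← sub_eq_add_neg, norm_vec_conjStar,
      vec_sub]
  obtain ⟨ζ, hζ⟩ := cauchySeq_tendsto_of_complete hcau
  have hζS : ζ = star S (hμ.vec 1) := by
    refine hμ.denseRange_vec.eq_of_inner_left (𝕜 := ℂ) ?_
    intro q
    have t1 : Filter.Tendsto (fun n => inner ℂ (hμ.vec (conjStar (p n))) (hμ.vec q)) Filter.atTop
        (𝓝 (inner ℂ ζ (hμ.vec q))) := hζ.inner tendsto_const_nhds
    have t2 : Filter.Tendsto (fun n => inner ℂ (hμ.vec (conjStar q)) (hμ.vec (p n))) Filter.atTop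
        (𝓝 (inner ℂ (hμ.vec (conjStar q)) (S (hμ.vec 1)))) := tendsto_const_nhds.inner hlim
    rw [hμ.inner_star_vac hS]
    refine tendsto_nhds_unique t1 (t2.congr fun n => ?_)
    rw [inner_vec, inner_vec, conjStar_conjStar, conjStar_conjStar, hμ.tracial]
  rwa [hζS] at hζ

/-- The vacuum state is tracial: both sides are limits of `μ(pₙ T) = μ(T pₙ)`, with `pₙ → S Ω`. -/
theorem inner_vac_mul_comm {S T : hμ.GNS →L[ℂ] hμ.GNS} (hS : S ∈ hμ.gnsAlgebra)
    (hT : T ∈ hμ.gnsAlgebra) :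
    inner ℂ (hμ.vec 1) (S (T (hμ.vec 1))) = inner ℂ (hμ.vec 1) (T (S (hμ.vec 1))) := by
  obtain ⟨p, hp, hp'⟩ := hμ.exists_tendsto_vec hS
  have t1 : Filter.Tendsto (fun n => inner ℂ (hμ.vec (conjStar (p n))) (T (hμ.vec 1)))
      Filter.atTop (𝓝 (inner ℂ (star S (hμ.vec 1)) (T (hμ.vec 1)))) :=
    hp'.inner tendsto_const_nhds
  have t2 : Filter.Tendsto (fun n => inner ℂ (star T (hμ.vec 1)) (hμ.vec (p n)))
      Filter.atTop (𝓝 (inner ℂ (star T (hμ.vec 1)) (S (hμ.vec 1)))) :=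
    tendsto_const_nhds.inner hp
  have h := tendsto_nhds_unique t1 (t2.congr fun n => hμ.inner_star_vac hT _)
  rwa [ContinuousLinearMap.star_eq_adjoint, ContinuousLinearMap.adjoint_inner_left,
    ContinuousLinearMap.star_eq_adjoint, ContinuousLinearMap.adjoint_inner_left] at h

/-- The vacuum vector is separating. -/
theorem eq_zero_of_apply_vac {T : hμ.GNS →L[ℂ] hμ.GNS} (hT : T ∈ hμ.gnsAlgebra)
    (h : T (hμ.vec 1) = 0) : T = 0 := by
  ext ξ
  refine hμ.denseRange_vec.induction_on (p := fun ξ => T ξ = 0) ξ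
    (isClosed_eq (by fun_prop) (by fun_prop)) fun a => ?_
  rw [vec_eq_right, ← hμ.mem_gnsAlgebra.1 hT, h, map_zero]

theorem inner_vac_star_mul (T : hμ.GNS →L[ℂ] hμ.GNS) :
    inner ℂ (hμ.vec 1) ((star T * T) (hμ.vec 1)) = ((‖T (hμ.vec 1)‖ ^ 2 : ℝ) : ℂ) := by
  rw [ContinuousLinearMap.star_eq_adjoint, mul_apply_eq_comp,
    ContinuousLinearMap.adjoint_inner_right, inner_self_eq_norm_sq_to_K]
  simp

/-- The tracial `W*`-algebra of a law: the trace is the vector state of the vacuum. -/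
def gnsTracialWStar : TracialWStar where
  H := hμ.GNS
  S := hμ.gnsAlgebra
  isClosed_sigmaWOT := hμ.isClosed_gnsAlgebra
  separable := separableSpace_induced_sigmaWOT _
  trace :=
    { toFun := fun T => inner ℂ (hμ.vec 1) ((T : hμ.GNS →L[ℂ] hμ.GNS) (hμ.vec 1))
      map_add' := fun S T => by simp [inner_add_right]
      map_smul' := fun c T => by simp [inner_smul_right] }
  trace_one := by
    change inner ℂ (hμ.vec 1) (hμ.vec 1) = 1
    rw [inner_vec, conjStar_one, mul_one, hμ.unital]
  trace_nonneg T := by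
    change 0 ≤ inner ℂ (hμ.vec 1)
      ((star (T : hμ.GNS →L[ℂ] hμ.GNS) * (T : hμ.GNS →L[ℂ] hμ.GNS)) (hμ.vec 1))
    rw [inner_vac_star_mul]
    exact Complex.zero_le_real.2 (sq_nonneg _)
  trace_mul_comm S T := hμ.inner_vac_mul_comm S.2 T.2
  trace_faithful T h := by
    change inner ℂ (hμ.vec 1)
      ((star (T : hμ.GNS →L[ℂ] hμ.GNS) * (T : hμ.GNS →L[ℂ] hμ.GNS)) (hμ.vec 1)) = 0 at h
    rw [inner_vac_star_mul] at h
    refine Subtype.ext (hμ.eq_zero_of_apply_vac T.2 ?_)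
    have h1 : ‖(T : hμ.GNS →L[ℂ] hμ.GNS) (hμ.vec 1)‖ ^ 2 = 0 := by exact_mod_cast h
    simpa using h1
  trace_normal := by
    let := sigmaWOT hμ.GNS
    exact (continuous_sigmaWOT_inner_self (hμ.vec 1)).comp continuous_induced_dom

/-- The left multiplications by the variables, a self-adjoint tuple of law `μ`. -/
def gnsTuple : hμ.gnsTracialWStar.SA d := fun j =>
  ⟨(⟨hμ.left (var j), hμ.left_mem_gnsAlgebra _⟩ : hμ.gnsAlgebra),
    Subtype.ext (hμ.isSelfAdjoint_left_var j)⟩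

/-- The operator underlying an element of the algebra of a law. -/
def gnsOp (a : hμ.gnsTracialWStar.A) : hμ.GNS →L[ℂ] hμ.GNS :=
  Subtype.val (p := (· ∈ hμ.gnsAlgebra)) a

theorem lift_gnsTuple_apply (w : FreeMonoid (Fin d)) (q : NCPoly d) :
    hμ.gnsOp (FreeMonoid.lift (toTuple hμ.gnsTuple) w) (hμ.vec q) =
      hμ.vec (MonoidAlgebra.single w 1 * q) := by
  induction w using FreeMonoid.inductionOn' with
  | one =>
    rw [map_one, ← MonoidAlgebra.one_def, one_mul]
    rfl
  | of_mul j w ih =>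
    have e : (MonoidAlgebra.single (FreeMonoid.of j * w) 1 : NCPoly d) =
        var j * MonoidAlgebra.single w 1 := by
      rw [var, MonoidAlgebra.single_mul_single, mul_one]
    rw [map_mul, FreeMonoid.lift_eval_of, e, mul_assoc, ← left_vec, ← ih]
    rfl

theorem law_gnsTuple : law hμ.gnsTuple = μ := by
  refine MonoidAlgebra.lhom_ext' fun w => LinearMap.ext_ring ?_
  have h1 : law hμ.gnsTuple (MonoidAlgebra.single w 1) = inner ℂ (hμ.vec 1)
      (hμ.gnsOp (FreeMonoid.lift (toTuple hμ.gnsTuple) w) (hμ.vec 1)) := by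
    have : law hμ.gnsTuple (MonoidAlgebra.single w 1) =
        hμ.gnsTracialWStar.τ (FreeMonoid.lift (toTuple hμ.gnsTuple) w) := by
      simp [law, NCPoly.eval]
    rw [this]
    rfl
  change law hμ.gnsTuple (MonoidAlgebra.single w 1) = μ (MonoidAlgebra.single w 1)
  rw [h1, lift_gnsTuple_apply, inner_vec, conjStar_one, one_mul, mul_one]

/-- Every non-commutative law is the law of a self-adjoint tuple. -/
theorem exists_law_eq (hμ : IsNCLaw μ) : ∃ r : Σ W : TracialWStar, W.SA d, law r.2 = μ :=
  ⟨⟨hμ.gnsTracialWStar, hμ.gnsTuple⟩, hμ.law_gnsTuple⟩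

end IsNCLaw

end

theorem proposition9p5 (d : ℕ) (k : ℕ∞) (hk : 2 ≤ k) (φ : NCFun d)
    (hφ : IsTrCtrKSelfAdjoint k φ) (K : ℝ) (hK : 0 < K)
    (hbound : bcNorm (derivForm (ncGradient φ) - K • idForm d) < ENNReal.ofReal K) :
    (∀ μ : NCPoly d →ₗ[ℂ] ℂ, IsNCLaw μ →
      couplingDist μ (pushforward (ncGradient φ) μ) =
        Real.sqrt (lawEval μ (trInnerFun (fun W X => ncGradient φ W X - X)
          (fun W X => ncGradient φ W X - X))).re) ∧
    (∀ (W : TracialWStar) (X : W.SA d),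
      IsOptimalCoupling X (ncGradient φ W X) (law X) (pushforward (ncGradient φ) (law X))) := by
  obtain ⟨c, h⟩ := isConvexGradient_ncGradient hk hφ hbound
  exact ⟨fun μ hμ => h.couplingDist_pushforward hμ.exists_law_eq, fun W X => h.isOptimalCoupling X⟩
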